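/- **Setting.** A (complex) tensor of order $d$ and dimension $n$ is an array $A=(a_{i_1\dots i_d})_{i_1,\dots,i_d\in[n]}$ of complex numbers, and its permanent is $$\mathrm{per}(A)=\sum_{\sigma_2,\dots,\sigma_d\in S_n}\ \prod_{i=1}^n a_{i\,\sigma_2(i)\dots\sigma_d(i)} .$$ Let $J$ be the tensor with all entries $1$, and for $0\le k\le n$ let $$a_k(A)=\frac{1}{\bigl(n(n-1)\cdots(n-k+1)\bigr)^{d-1}}\sum_{B}\mathrm{per}(B),$$ where $B$ runs over all $k\times\dots\times k$ subtensors of $A$ (one $k$-element subset of $[n]$ chosen in each of the $d$ index positions). Algorithms are deterministic random access machines over $\mathbb C\cong\mathbb R^2$ in the style of Blum, Shub and Smale: arithmetic operations on complex numbers, comparisons of real parts, and additions, truncated subtractions, comparisons and indirect addressing with natural-number indices cost one step each; a program is finite and may contain finitely many complex constants. **Theorem.** Fix a constant $c\in(0,\tfrac18)$. There are a deterministic algorithm $\mathscr P$ and a constant $K$ such that the following holds. 1. For all $d\ge 3$, $n\ge 0$, all tensors $A$ of order $d$ and dimension $n$, and all $z\in\mathbb C$, $$\frac{\mathrm{per}(J+zA)}{(n!)^{d-1}}=\sum_{k=0}^n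 a_k(A)\,z^k .$$ 2. For all $d\ge3$, $n\ge2$, every tensor $R$ of order $d$ and dimension $n$, every $\mu\in\mathbb C\setminus\{0\}$ and every real $\varepsilon\in(0,1)$, the algorithm $\mathscr P$ on input $(n,d,R,\mu,\varepsilon)$ halts after at most $n^{K d\ln(n/\varepsilon)}$ steps (quasi-polynomial time if $d=O(\mathrm{polylog}\,n)$) and outputs the truncated expansion $$\mathscr P(R,\varepsilon)=\mu^n (n!)^{d-1}\sum_{0\le k\le \min(n,\,\ln(n/\varepsilon))} a_k(A)\,z^k,\qquad z=\frac1\mu,\quad A=R-\mu J .$$ 3. Let $d=d(n)\ge 3$ with $d(n)=O\bigl((\ln n)^m\bigr)$ for some $m$, and let $\rho$ be a real number. Let $R$ be a random tensor of order $d(n)$ and dimension $n$ whose entries are i.i.d. complex random variables with mean $\mu$, variance $1$ and third absolute central moment at most $\rho$, where $$|\mu|\ \ge\ \Bigl(\frac{\ln n}{(d(n)-1)^6}\Bigr)^{-c}.$$ Then $$\mathbb P\left(\mathrm{per}(R)\ne0\ \text{ and }\ \left|1-\frac{\mathscr P(R,\varepsilon)}{\mathrm{per}(R)}\right|\le\varepsilon\right)\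 \ge\ 1-o(1)\qquad(n\to\infty),$$ where, for the given $d(\cdot)$ and $\rho$, the $o(1)$ term is uniform in $\mu$, in the distribution of the entries and in $\varepsilon\in(0,1)$. -/

import Mathlib

open MeasureTheory Filter Asymptotics

/-! ### Tensors and permanents -/

/-- Complex tensors of order `d` and dimension `n`: arrays indexed by `d` indices, each in `[n]`. -/
abbrev Tensor (d n : ℕ) : Type := (Fin d → Fin n) → ℂ

/-- The permanent of a tensor of order `d ≥ 1`: the sum, over all choices of bijections
`σ_k` of `[n]` for the second up to the last index position, of the products
`∏ i, A (i, σ_2 i, …, σ_d i)`; the first index is not permuted. -/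
noncomputable def Tensor.per {d n : ℕ} (A : Tensor d n) : ℂ :=
  ∑ σ : Fin d → Equiv.Perm (Fin n) with ∀ k : Fin d, k.val = 0 → σ k = 1,
    ∏ i : Fin n, A (fun k => σ k i)

/-- The tensor all of whose entries are `1`. -/
def Tensor.allOnes (d n : ℕ) : Tensor d n := fun _ => 1

/-- The `k × ⋯ × k` subtensor of `A` selected, in each of the `d` index positions, by a
`k`-element subset of `[n]`, given through its increasing enumeration. -/
def Tensor.subtensor {d n k : ℕ} (A : Tensor d n) (S : Fin d → (Fin k ↪o Fin n)) : Tensor d k :=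
  fun i => A (fun j => S j (i j))

/-- The coefficient `a_k`: the sum of the permanents of all `k × ⋯ × k` subtensors of `A`,
divided by `(n (n - 1) ⋯ (n - k + 1)) ^ (d - 1)`. -/
noncomputable def Tensor.coeff {d n : ℕ} (A : Tensor d n) (k : ℕ) : ℂ :=
  1 / ((n.descFactorial k : ℂ) ^ (d - 1)) *
    ∑ S : Fin d → (Fin k ↪o Fin n), (A.subtensor S).per

/-- The truncated expansion. Writing `z = 1 / μ` and `A = R - μ J`, one has `R = μ (J + z A)`, so that
`per R = μ ^ n (n!) ^ (d - 1) ∑ k ≤ n, a_k z ^ k`; only the terms with `k ≤ ln (n / ε)` are kept. -/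
noncomputable def Tensor.truncatedPer {d n : ℕ} (R : Tensor d n) (μ : ℂ) (ε : ℝ) : ℂ :=
  μ ^ n * (n.factorial : ℂ) ^ (d - 1) *
    ∑ k ∈ (Finset.range (n + 1)).filter (fun k : ℕ => (k : ℝ) ≤ Real.log (n / ε)),
      Tensor.coeff (R - μ • Tensor.allOnes d n) k * (1 / μ) ^ k

/-! ### Random tensors -/

/-- `ν` is an entry distribution: a probability law on `ℂ` with mean `μ`, variance `1` and finite
third absolute central moment, which is at most `ρ`. -/
structure IsEntryDistribution (ν : Measure ℂ) (μ : ℂ) (ρ : ℝ) : Prop where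
  isProbabilityMeasure : IsProbabilityMeasure ν
  integrable_third : Integrable (fun x : ℂ => ‖x - μ‖ ^ 3) ν
  mean : ∫ x, x ∂ν = μ
  variance : ∫ x, ‖x - μ‖ ^ 2 ∂ν = 1
  third_le : ∫ x, ‖x - μ‖ ^ 3 ∂ν ≤ ρ

/-- The law of a random tensor of order `d` and dimension `n` with i.i.d. entries of law `ν`. -/
noncomputable def tensorLaw (d n : ℕ) (ν : Measure ℂ) : Measure (Tensor d n) :=
  Measure.pi (fun _ : Fin d → Fin n => ν)

/-! ### The machine model

Deterministic random access machines over the complex numbers in the style of Blum, Shub and Smale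
(`ℂ` being identified with `ℝ²`, so that real parts can be compared). A machine has an index memory
holding natural numbers and a number memory holding complex numbers, both with indirect addressing,
and a read-only input array of complex numbers. Programs are structured and finite, with finitely
many complex machine constants. Every elementary instruction and every test costs one step. -/

/-- The memory of a machine. -/
structure Store where
  /-- the index memory -/
  idx : ℕ → ℕ
  /-- the number memory -/
  num : ℕ → ℂ

/-- Overwrite one cell of the index memory. -/
def Store.setIdx (s : Store) (i v : ℕ) : Store := ⟨Function.update s.idx i v, s.num⟩

/-- Overwrite one cell of the number memory. -/
def Store.setNum (s : Store) (i : ℕ) (v : ℂ) : Store := ⟨s.idx, Function.update s.num i v⟩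

/-- Elementary instructions. -/
inductive Instr : Type
  /-- `idx[i] := v` -/
  | idxConst (i v : ℕ)
  /-- `idx[i] := idx[j] + idx[k]` -/
  | idxAdd (i j k : ℕ)
  /-- `idx[i] := max (idx[j] - idx[k]) 0` -/
  | idxSub (i j k : ℕ)
  /-- `idx[i] := idx[idx[j]]` -/
  | idxLoad (i j : ℕ)
  /-- `idx[idx[i]] := idx[j]` -/
  | idxStore (i j : ℕ)
  /-- `num[i] := v` -/
  | numConst (i : ℕ) (v : ℂ)
  /-- `num[i] := num[j] + num[k]` -/
  | numAdd (i j k : ℕ)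
  /-- `num[i] := num[j] - num[k]` -/
  | numSub (i j k : ℕ)
  /-- `num[i] := num[j] * num[k]` -/
  | numMul (i j k : ℕ)
  /-- `num[i] := num[j] / num[k]` (and `0` if `num[k] = 0`) -/
  | numDiv (i j k : ℕ)
  /-- `num[i] := num[idx[j]]` -/
  | numLoad (i j : ℕ)
  /-- `num[idx[i]] := num[j]` -/
  | numStore (i j : ℕ)
  /-- `num[i] := input[idx[j]]` -/
  | input (i j : ℕ)

/-- The effect of an elementary instruction, with input array `inp`. -/
noncomputable def Instr.exec (inp : ℕ → ℂ) (s : Store) : Instr → Store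
  | .idxConst i v => s.setIdx i v
  | .idxAdd i j k => s.setIdx i (s.idx j + s.idx k)
  | .idxSub i j k => s.setIdx i (s.idx j - s.idx k)
  | .idxLoad i j => s.setIdx i (s.idx (s.idx j))
  | .idxStore i j => s.setIdx (s.idx i) (s.idx j)
  | .numConst i v => s.setNum i v
  | .numAdd i j k => s.setNum i (s.num j + s.num k)
  | .numSub i j k => s.setNum i (s.num j - s.num k)
  | .numMul i j k => s.setNum i (s.num j * s.num k)
  | .numDiv i j k => s.setNum i (s.num j / s.num k)
  | .numLoad i j => s.setNum i (s.num (s.idx j))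
  | .numStore i j => s.setNum (s.idx i) (s.num j)
  | .input i j => s.setNum i (inp (s.idx j))

/-- Tests. -/
inductive Test : Type
  /-- `idx[i] ≤ idx[j]` -/
  | idxLe (i j : ℕ)
  /-- `Re num[i] ≤ Re num[j]` -/
  | numLe (i j : ℕ)

/-- The outcome of a test. -/
def Test.Holds (s : Store) : Test → Prop
  | .idxLe i j => s.idx i ≤ s.idx j
  | .numLe i j => (s.num i).re ≤ (s.num j).re

/-- Programs. -/
inductive Program : Type
  | instr (a : Instr)
  | seq (p q : Program)
  | ite (b : Test) (p q : Program)
  | while (b : Test) (p : Program)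

/-- `Program.Runs inp p s s' T`: with input array `inp`, the program `p` started in memory `s`
halts in memory `s'` after exactly `T` steps. -/
inductive Program.Runs (inp : ℕ → ℂ) : Program → Store → Store → ℕ → Prop
  | instr (a : Instr) (s : Store) : Program.Runs inp (.instr a) s (a.exec inp s) 1
  | seq {p q : Program} {s s' s'' : Store} {T T' : ℕ} :
      Program.Runs inp p s s' T → Program.Runs inp q s' s'' T' →
      Program.Runs inp (.seq p q) s s'' (T + T')
  | iteTrue {b : Test} {p q : Program} {s s' : Store} {T : ℕ} :
      b.Holds s → Program.Runs inp p s s' T → Program.Runs inp (.ite b p q) s s' (T + 1)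
  | iteFalse {b : Test} {p q : Program} {s s' : Store} {T : ℕ} :
      ¬ b.Holds s → Program.Runs inp q s s' T → Program.Runs inp (.ite b p q) s s' (T + 1)
  | whileTrue {b : Test} {p : Program} {s s' s'' : Store} {T T' : ℕ} :
      b.Holds s → Program.Runs inp p s s' T → Program.Runs inp (.while b p) s' s'' T' →
      Program.Runs inp (.while b p) s s'' (T + T' + 1)
  | whileFalse {b : Test} {p : Program} {s : Store} :
      ¬ b.Holds s → Program.Runs inp (.while b p) s s 1

/-- The machines are deterministic: the final memory and the number of steps are determined by the
program, the input array and the initial memory. -/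
theorem Program.Runs.deterministic {inp : ℕ → ℂ} {p : Program} {s s₁ s₂ : Store} {T₁ T₂ : ℕ}
    (h₁ : Program.Runs inp p s s₁ T₁) (h₂ : Program.Runs inp p s s₂ T₂) :
    s₁ = s₂ ∧ T₁ = T₂ := by
  induction h₁ generalizing s₂ T₂ with
  | instr a s => cases h₂; exact ⟨rfl, rfl⟩
  | seq _ _ ih ih' =>
    cases h₂ with
    | seq a b =>
      obtain ⟨rfl, rfl⟩ := ih a
      obtain ⟨rfl, rfl⟩ := ih' b
      exact ⟨rfl, rfl⟩
  | iteTrue hb _ ih =>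
    cases h₂ with
    | iteTrue _ a => obtain ⟨rfl, rfl⟩ := ih a; exact ⟨rfl, rfl⟩
    | iteFalse hb' _ => exact absurd hb hb'
  | iteFalse hb _ ih =>
    cases h₂ with
    | iteTrue hb' _ => exact absurd hb' hb
    | iteFalse _ a => obtain ⟨rfl, rfl⟩ := ih a; exact ⟨rfl, rfl⟩
  | whileTrue hb _ _ ih ih' =>
    cases h₂ with
    | whileTrue _ a b =>
      obtain ⟨rfl, rfl⟩ := ih a
      obtain ⟨rfl, rfl⟩ := ih' b
      exact ⟨rfl, rfl⟩
    | whileFalse hb' => exact absurd hb hb'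
  | whileFalse hb =>
    cases h₂ with
    | whileTrue hb' _ _ => exact absurd hb' hb
    | whileFalse _ => exact ⟨rfl, rfl⟩

/-- The input array of a tensor: with indices counted from `0`, the entry with indices
`(i_0, …, i_(d-1))` stands at position `∑ j, i_j * n ^ j`. -/
noncomputable def Tensor.inputArray {d n : ℕ} (R : Tensor d n) : ℕ → ℂ :=
  fun m => if h : m < n ^ d then R (finFunctionFinEquiv.symm ⟨m, h⟩) else 0

/-- The initial memory: `n` and `d` in the first two index cells, `μ` and `ε` in the first two number
cells, `0` everywhere else. -/
noncomputable def initialStore (n d : ℕ) (μ : ℂ) (ε : ℝ) : Store where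
  idx := fun i => if i = 0 then n else if i = 1 then d else 0
  num := fun i => if i = 0 then μ else if i = 1 then (ε : ℂ) else 0

/-- On the input `(n, d, R, μ, ε)`, the program `p` halts after exactly `T` steps with output `y`,
the content of the first number cell. -/
def Program.Outputs (p : Program) {d n : ℕ} (R : Tensor d n) (μ : ℂ) (ε : ℝ) (y : ℂ) (T : ℕ) :
    Prop :=
  ∃ s : Store, Program.Runs R.inputArray p (initialStore n d μ ε) s T ∧ s.num 0 = y

/-! Expansion. Let the first index be permuted too, at the price of a factor n!, and expand ∏ (1 + z
A) over subsets T of [n]. An injection of [k] into [n] extends to (n - k)! permutations, so T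
contributes only through its cardinality, and collecting by k gives the coefficients a_k
(`Tensor.per_allOnes_add_smul`).

Approximation. Put z = 1/μ and A = R - μJ, so that A has independent centred entries of variance 1.
Each monomial of a_k is a product over a set of k positions, and distinct monomials have distinct
sets; hence all monomials, for all k together, are orthonormal. With D = n(n-1)⋯(n-k+1), there are
D^d / k! monomials with coefficient D^(-(d-1)) each, so E|a_k|² = 1 / (k! D^(d-2)) ≤ 1 / (k! n) for
k ≥ 1 and d ≥ 3 (`integral_norm_sq_sum_coeff_le`). Since a_0 = 1, Chebyshev's inequality keeps the
whole sum above 1/2 in modulus. In the discarded tail ε e^k > n ≥ 1, so inserting ε² e^(2k) bounds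
its second moment by ε² exp(e²|z|²) / n; the tail is below ε/2 with a failure probability free of ε
(`tensorLaw_bad_le`). As |z| ≤ (ln n)^c with 2c < 1, exp(e²|z|²) / n tends to 0.

Algorithm. Each a_k is summed by brute force over the (n^d)^k tuples of positions, encoded as
integers whose digits are read off by division. The running time comes from a small calculus:
functions computable in time polynomial in a size W are closed under arithmetic and bounded loops
(`Ctx.Computes.loop`), and the truncated expansion is a formula built from these. With W =
n^(d(degree + 1)) this is the quasi-polynomial bound. -/

/-! ### Permanents and injections -/

/-- Every injection of `Fin k` is, uniquely, an increasing one after a permutation. -/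
noncomputable def orderEmbProdPermEquiv (k n : ℕ) :
    (Fin k ↪o Fin n) × Equiv.Perm (Fin k) ≃ (Fin k ↪ Fin n) :=
  Equiv.ofBijective (fun p => p.2.toEmbedding.trans p.1.toEmbedding) <| by
    constructor
    · rintro ⟨S, σ⟩ ⟨S', σ'⟩ h
      have h1 : ∀ i, S (σ i) = S' (σ' i) := fun i => DFunLike.congr_fun h i
      have hS : S = S' := by
        refine OrderEmbedding.range_inj.1 (Set.ext fun y => ⟨?_, ?_⟩)
        · rintro ⟨i, rfl⟩
          exact ⟨σ' (σ.symm i), by rw [← h1]; simp⟩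
        · rintro ⟨i, rfl⟩
          exact ⟨σ (σ'.symm i), by rw [h1]; simp⟩
      subst hS
      have : σ = σ' := Equiv.ext fun i => S.injective (h1 i)
      rw [this]
    · intro g
      have hc : (Finset.univ.map g).card = k := by simp
      have hg : ∀ i, ∃ j, (Finset.univ.map g).orderEmbOfFin hc j = g i := fun i => by
        have : g i ∈ Set.range ((Finset.univ.map g).orderEmbOfFin hc) := by
          rw [Finset.range_orderEmbOfFin]; simp
        exact this
      choose τ hτ using hg
      have hinj : Function.Injective τ := fun a b hab => g.injective (by rw [← hτ, ← hτ, hab])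
      refine ⟨⟨(Finset.univ.map g).orderEmbOfFin hc,
        Equiv.ofBijective τ (Finite.injective_iff_bijective.1 hinj)⟩, ?_⟩
      ext i
      simp [hτ]

theorem card_orderEmb_mul_factorial (k n : ℕ) :
    Fintype.card (Fin k ↪o Fin n) * k.factorial = n.descFactorial k := by
  have := Fintype.card_congr (orderEmbProdPermEquiv k n)
  simpa [Fintype.card_prod, Fintype.card_perm, Fintype.card_embedding_eq] using this

/-- Permuting the first index as well repeats every term `k!` times. -/
theorem sum_perm_prod_eq {d k : ℕ} (hd : 0 < d) (B : Tensor d k) :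
    ∑ τ : Fin d → Equiv.Perm (Fin k), ∏ i, B (fun j => τ j i) = (k.factorial : ℂ) * B.per := by
  have h1 : (k.factorial : ℂ) * B.per =
      ∑ π : Equiv.Perm (Fin k),
        ∑ σ : Fin d → Equiv.Perm (Fin k) with ∀ j : Fin d, j.val = 0 → σ j = 1,
          ∏ i, B (fun j => σ j (π i)) := by
    have : ∀ π : Equiv.Perm (Fin k),
        ∑ σ : Fin d → Equiv.Perm (Fin k) with ∀ j : Fin d, j.val = 0 → σ j = 1,
          ∏ i, B (fun j => σ j (π i)) = B.per := fun π => by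
      refine Finset.sum_congr rfl fun σ _ => ?_
      exact Equiv.prod_comp π (fun i => B (fun j => σ j i))
    rw [Finset.sum_congr rfl fun π _ => this π]
    simp [Fintype.card_perm]
  rw [h1, ← Finset.sum_product']
  -- The bijection normalises τ at the first index: τ corresponds to (τ_0, (τ_j τ_0⁻¹)_j).
  refine Finset.sum_bij' (fun τ _ => (τ ⟨0, hd⟩, fun j => τ j * (τ ⟨0, hd⟩)⁻¹))
    (fun p _ => fun j => p.2 j * p.1) ?_ ?_ ?_ ?_ ?_
  · intro τ _
    simp only [Finset.mem_product, Finset.mem_univ, true_and, Finset.mem_filter]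
    intro j hj
    have : j = ⟨0, hd⟩ := Fin.ext hj
    subst this
    simp
  · intro p _
    simp
  · intro τ _
    ext j i
    simp
  · rintro ⟨π, σ⟩ h
    simp only [Finset.mem_product, Finset.mem_univ, true_and, Finset.mem_filter] at h
    have h0 := h ⟨0, hd⟩ rfl
    simp [h0]
  · intro τ _
    simp

/-- This is `sum_perm_prod_eq` for the all-ones tensor, where both sides merely count. -/
theorem card_normalized_perms {d : ℕ} (hd : 0 < d) (k : ℕ) :
    (Finset.univ.filter fun σ : Fin d → Equiv.Perm (Fin k) =>
      ∀ j : Fin d, j.val = 0 → σ j = 1).card = k.factorial ^ (d - 1) := by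
  have h := sum_perm_prod_eq (k := k) hd (Tensor.allOnes d k)
  simp only [Tensor.allOnes, Tensor.per, Finset.prod_const_one, Finset.sum_const, nsmul_eq_mul,
    mul_one, Finset.card_univ, Fintype.card_fun, Fintype.card_perm, Fintype.card_fin] at h
  have h' : k.factorial ^ d = k.factorial *
      (Finset.univ.filter fun σ : Fin d → Equiv.Perm (Fin k) =>
        ∀ j : Fin d, j.val = 0 → σ j = 1).card := by exact_mod_cast h
  obtain ⟨e, rfl⟩ : ∃ e, d = e + 1 := ⟨d - 1, by omega⟩
  rw [pow_succ'] at h'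
  exact (Nat.eq_of_mul_eq_mul_left k.factorial_pos h').symm

/-- The sum of the products of `k` entries, over all ordered `k`-tuples of positions which pairwise
differ in every index. -/
noncomputable def Tensor.injSum {d n : ℕ} (A : Tensor d n) (k : ℕ) : ℂ :=
  ∑ g : Fin d → (Fin k ↪ Fin n), ∏ i, A (fun j => g j i)

/-- Factoring each injection into an increasing map and a permutation turns the inner sum into one
over all d-tuples of permutations, to which `sum_perm_prod_eq` applies. -/
theorem Tensor.injSum_eq {d n : ℕ} (hd : 0 < d) (A : Tensor d n) (k : ℕ) :
    A.injSum k = (k.factorial : ℂ) * ∑ S : Fin d → (Fin k ↪o Fin n), (A.subtensor S).per := by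
  have h1 : A.injSum k = ∑ p : (Fin d → (Fin k ↪o Fin n)) × (Fin d → Equiv.Perm (Fin k)),
      ∏ i, A (fun j => p.1 j (p.2 j i)) := by
    refine (Fintype.sum_equiv ((Equiv.arrowProdEquivProdArrow _ _ _).symm.trans
      (Equiv.arrowCongr (Equiv.refl (Fin d)) (orderEmbProdPermEquiv k n))) _ _ ?_).symm
    intro p
    rfl
  rw [h1, Fintype.sum_prod_type, Finset.mul_sum]
  refine Finset.sum_congr rfl fun S _ => ?_
  rw [← sum_perm_prod_eq hd]
  rfl

theorem Tensor.coeff_eq_injSum {d n : ℕ} (hd : 0 < d) (A : Tensor d n) (k : ℕ) :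
    A.coeff k = 1 / ((n.descFactorial k : ℂ) ^ (d - 1) * k.factorial) * A.injSum k := by
  have : (k.factorial : ℂ) ≠ 0 := by exact_mod_cast k.factorial_ne_zero
  rw [Tensor.injSum_eq hd, Tensor.coeff]
  field_simp

theorem exists_perm_trans_eq {k n : ℕ} (g g' : Fin k ↪ Fin n) :
    ∃ π : Equiv.Perm (Fin n), g.trans π.toEmbedding = g' := by
  obtain ⟨π, hπ⟩ := Equiv.Perm.exists_extending_pair g g' g.injective g'.injective
  exact ⟨π, by ext i; simpa using congrArg Fin.val (hπ i)⟩

/-- Composing with a permutation that carries g to g' maps the fibre over g injectively into the one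
over g'. All fibres therefore have equal size, and together they exhaust the n! permutations. -/
theorem card_perm_extending {k n : ℕ} (e g : Fin k ↪ Fin n) :
    (Finset.univ.filter fun σ : Equiv.Perm (Fin n) => e.trans σ.toEmbedding = g).card =
      (n - k).factorial := by
  have hk : k ≤ n := by simpa using Fintype.card_le_of_embedding g
  have hle : ∀ g g' : Fin k ↪ Fin n,
      (Finset.univ.filter fun σ : Equiv.Perm (Fin n) => e.trans σ.toEmbedding = g).card ≤
      (Finset.univ.filter fun σ : Equiv.Perm (Fin n) => e.trans σ.toEmbedding = g').card := by
    intro g g'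
    obtain ⟨π, hπ⟩ := exists_perm_trans_eq g g'
    refine Finset.card_le_card_of_injOn (fun σ => π * σ) ?_ (mul_right_injective π).injOn
    intro σ hσ
    simp only [Finset.coe_filter, Finset.mem_univ, true_and, Set.mem_ofPred_eq] at hσ ⊢
    rw [← hπ, ← hσ]
    rfl
  have hsum : n.descFactorial k *
      (Finset.univ.filter fun σ : Equiv.Perm (Fin n) => e.trans σ.toEmbedding = g).card =
        n.factorial := by
    have := Finset.card_eq_sum_card_fiberwise (s := (Finset.univ : Finset (Equiv.Perm (Fin n))))
      (t := (Finset.univ : Finset (Fin k ↪ Fin n))) (f := fun σ => e.trans σ.toEmbedding)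
      (fun _ _ => by simp)
    rw [Finset.sum_congr rfl fun g' _ => le_antisymm (hle g' g) (hle g g')] at this
    simpa [Fintype.card_perm, Fintype.card_embedding_eq] using this.symm
  rw [← Nat.factorial_mul_descFactorial hk, mul_comm] at hsum
  exact Nat.eq_of_mul_eq_mul_right (Nat.descFactorial_pos.2 hk) hsum

theorem sum_perm_comp_eq {d k n : ℕ} (e : Fin k ↪ Fin n) (G : (Fin d → (Fin k ↪ Fin n)) → ℂ) :
    ∑ σ : Fin d → Equiv.Perm (Fin n), G (fun j => e.trans (σ j).toEmbedding) =
      ((n - k).factorial : ℂ) ^ d * ∑ g, G g := by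
  rw [← Finset.sum_fiberwise_of_maps_to (s := Finset.univ) (t := Finset.univ)
    (g := fun σ : Fin d → Equiv.Perm (Fin n) => fun j => e.trans (σ j).toEmbedding)
    (fun _ _ => Finset.mem_univ _), Finset.mul_sum]
  refine Finset.sum_congr rfl fun g _ => ?_
  have hcard : (Finset.univ.filter fun σ : Fin d → Equiv.Perm (Fin n) =>
      (fun j => e.trans (σ j).toEmbedding) = g).card = (n - k).factorial ^ d := by
    have : (Finset.univ.filter fun σ : Fin d → Equiv.Perm (Fin n) =>
        (fun j => e.trans (σ j).toEmbedding) = g) = Fintype.piFinset fun j =>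
          Finset.univ.filter fun σ : Equiv.Perm (Fin n) => e.trans σ.toEmbedding = g j := by
      ext σ
      simp [funext_iff]
    rw [this, Fintype.card_piFinset]
    simp [card_perm_extending]
  rw [Finset.sum_congr rfl (g := fun _ => G g) fun σ hσ => by rw [(Finset.mem_filter.1 hσ).2]]
  rw [Finset.sum_const, hcard]
  simp

theorem Tensor.per_allOnes_add_smul {d n : ℕ} (hd : 0 < d) (A : Tensor d n) (z : ℂ) :
    Tensor.per (Tensor.allOnes d n + z • A) / (n.factorial : ℂ) ^ (d - 1) =
      ∑ k ∈ Finset.range (n + 1), A.coeff k * z ^ k := by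
  have hn : (n.factorial : ℂ) ≠ 0 := by exact_mod_cast n.factorial_ne_zero
  -- Enumerating T increasingly turns the restriction of σ to T into a tuple of injections of Fin
  -- |T|; each tuple arises from (n - |T|)!^d choices of σ.
  have hsub : ∀ T : Finset (Fin n), ∑ σ : Fin d → Equiv.Perm (Fin n),
      ∏ i ∈ T, z * A (fun j => σ j i) =
        z ^ T.card * (((n - T.card).factorial : ℂ) ^ d * A.injSum T.card) := by
    intro T
    rw [Tensor.injSum, ← sum_perm_comp_eq (T.orderEmbOfFin rfl).toEmbedding
      (fun g => ∏ i, A (fun j => g j i)), Finset.mul_sum]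
    refine Finset.sum_congr rfl fun σ _ => ?_
    rw [Finset.prod_mul_distrib, Finset.prod_const]
    congr 1
    conv_lhs => rw [← Finset.image_orderEmbOfFin_univ T rfl]
    rw [Finset.prod_image fun a _ b _ h => (T.orderEmbOfFin rfl).injective h]
    rfl
  have hmain : (n.factorial : ℂ) * Tensor.per (Tensor.allOnes d n + z • A) =
      ∑ k ∈ Finset.range (n + 1),
        (n.choose k : ℂ) * (z ^ k * (((n - k).factorial : ℂ) ^ d * A.injSum k)) := by
    rw [← sum_perm_prod_eq hd]
    simp only [Pi.add_apply, Tensor.allOnes, Pi.smul_apply, smul_eq_mul]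
    simp_rw [Finset.prod_one_add]
    rw [Finset.sum_comm, Finset.sum_congr rfl fun T _ => hsub T,
      Finset.sum_powerset_apply_card (fun k => z ^ k * (((n - k).factorial : ℂ) ^ d * A.injSum k))]
    simp
  have : Tensor.per (Tensor.allOnes d n + z • A) / (n.factorial : ℂ) ^ (d - 1) =
      (n.factorial : ℂ) * Tensor.per (Tensor.allOnes d n + z • A) / (n.factorial : ℂ) ^ d := by
    obtain ⟨e, rfl⟩ : ∃ e, d = e + 1 := ⟨d - 1, by omega⟩
    rw [pow_succ, Nat.add_sub_cancel]
    field_simp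
  rw [this, hmain, Finset.sum_div]
  refine Finset.sum_congr rfl fun k hk => ?_
  have hk : k ≤ n := Nat.lt_succ_iff.1 (Finset.mem_range.1 hk)
  have h1 : ((n - k).factorial : ℂ) * n.descFactorial k = n.factorial := by
    exact_mod_cast Nat.factorial_mul_descFactorial hk
  have h3 : ((n - k).factorial : ℂ) ≠ 0 := by exact_mod_cast (n - k).factorial_ne_zero
  have h4 : (k.factorial : ℂ) ≠ 0 := by exact_mod_cast k.factorial_ne_zero
  have h5 : (n.descFactorial k : ℂ) ≠ 0 := by
    exact_mod_cast (Nat.descFactorial_pos.2 hk).ne'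
  have h6 : (n.choose k : ℂ) * k.factorial = n.descFactorial k := by
    exact_mod_cast (by rw [Nat.descFactorial_eq_factorial_mul_choose, mul_comm] :
      n.choose k * k.factorial = n.descFactorial k)
  obtain ⟨e, rfl⟩ : ∃ e, d = e + 1 := ⟨d - 1, by omega⟩
  rw [Tensor.coeff_eq_injSum hd, ← h1, Nat.add_sub_cancel]
  have h7 : (n.choose k : ℂ) = n.descFactorial k / k.factorial := by
    rw [← h6]; field_simp
  rw [h7]
  field_simp
  ring

/-! ### Second moments -/

/-- Products of centered independent variables over distinct index sets are orthonormal. -/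
theorem integral_norm_sq_sum_monomials {P ι : Type*} [Fintype P] [DecidableEq P] [Fintype ι]
    (ν : Measure ℂ) [IsProbabilityMeasure ν] {μ : ℂ} (hint : Integrable (fun x => x - μ) ν)
    (hsq : Integrable (fun x => ‖x - μ‖ ^ 2) ν) (hmean : ∫ x, (x - μ) ∂ν = 0)
    (hvar : ∫ x, ‖x - μ‖ ^ 2 ∂ν = 1) (U : ι → Finset P) (hU : Function.Injective U) (c : ι → ℂ) :
    Integrable (fun R : P → ℂ => ‖∑ i, c i * ∏ p ∈ U i, (R p - μ)‖ ^ 2)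
        (Measure.pi fun _ => ν) ∧
      ∫ R : P → ℂ, ‖∑ i, c i * ∏ p ∈ U i, (R p - μ)‖ ^ 2 ∂(Measure.pi fun _ => ν) =
        ∑ i, ‖c i‖ ^ 2 := by
  classical
  set conj := starRingEnd ℂ
  -- The contribution of position p to the i-th monomial times the conjugate of the j-th. Its mean
  -- is 1 if p lies in both sets or in neither, and 0 otherwise.
  let g : ι → ι → P → ℂ → ℂ := fun i j p x =>
    (if p ∈ U i then x - μ else 1) * (if p ∈ U j then conj (x - μ) else 1)
  have hcsq : (fun x : ℂ => (x - μ) * conj (x - μ)) = fun x => ((‖x - μ‖ ^ 2 : ℝ) : ℂ) := by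
    ext x
    rw [Complex.mul_conj, Complex.normSq_eq_norm_sq]
  have hconj : Integrable (fun x => conj (x - μ)) ν :=
    (Complex.conjLIE.toContinuousLinearEquiv.toContinuousLinearMap).integrable_comp hint
  have hgi : ∀ i j p, Integrable (g i j p) ν := by
    intro i j p
    by_cases h1 : p ∈ U i <;> by_cases h2 : p ∈ U j <;> simp only [g, h1, h2, if_true, if_false,
      mul_one, one_mul]
    · rw [hcsq]; exact hsq.ofReal
    · exact hint
    · exact hconj
    · exact integrable_const _
  have hgint : ∀ i j p, ∫ x, g i j p x ∂ν = if (p ∈ U i ↔ p ∈ U j) then 1 else 0 := by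
    intro i j p
    by_cases h1 : p ∈ U i <;> by_cases h2 : p ∈ U j <;> simp only [g, h1, h2, if_true, if_false,
      mul_one, one_mul, iff_true, iff_false, not_true]
    · rw [hcsq, integral_complex_ofReal, hvar]; simp
    · exact hmean
    · rw [integral_conj, hmean]; simp
    · simp
  have hexp : ∀ R : P → ℂ, ((‖∑ i, c i * ∏ p ∈ U i, (R p - μ)‖ ^ 2 : ℝ) : ℂ) =
      ∑ i, ∑ j, c i * conj (c j) * ∏ p, g i j p (R p) := by
    intro R
    rw [← Complex.normSq_eq_norm_sq, ← Complex.mul_conj, map_sum, Finset.sum_mul_sum]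
    refine Finset.sum_congr rfl fun i _ => Finset.sum_congr rfl fun j _ => ?_
    simp only [g, map_mul, map_prod]
    rw [Finset.prod_mul_distrib, Finset.prod_ite_mem, Finset.prod_ite_mem, Finset.univ_inter,
      Finset.univ_inter]
    ring
  have hterm : ∀ i j, Integrable (fun R : P → ℂ => c i * conj (c j) * ∏ p, g i j p (R p))
      (Measure.pi fun _ => ν) := fun i j =>
    (Integrable.fintype_prod (hgi i j)).const_mul _
  have hI : Integrable (fun R : P → ℂ => ((‖∑ i, c i * ∏ p ∈ U i, (R p - μ)‖ ^ 2 : ℝ) : ℂ))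
      (Measure.pi fun _ => ν) := by
    simp_rw [hexp]
    exact integrable_finsetSum _ fun i _ => integrable_finsetSum _ fun j _ => hterm i j
  refine ⟨hI.re, ?_⟩
  have hv : ∫ R : P → ℂ, ((‖∑ i, c i * ∏ p ∈ U i, (R p - μ)‖ ^ 2 : ℝ) : ℂ)
      ∂(Measure.pi fun _ => ν) = ((∑ i, ‖c i‖ ^ 2 : ℝ) : ℂ) := by
    simp_rw [hexp]
    rw [integral_finsetSum _ fun i _ => integrable_finsetSum _ fun j _ => hterm i j, Complex.ofReal_sum]
    refine Finset.sum_congr rfl fun i _ => ?_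
    rw [integral_finsetSum _ fun j _ => hterm i j, Finset.sum_eq_single i]
    · rw [integral_const_mul, integral_fintype_prod_eq_prod]
      simp [hgint, conj, Complex.mul_conj, Complex.normSq_eq_norm_sq]
    · intro j _ hj
      rw [integral_const_mul, integral_fintype_prod_eq_prod]
      -- A position in exactly one of the two sets contributes a lone centred factor, which
      -- annihilates the integral.
      have : ∃ p, ¬ (p ∈ U i ↔ p ∈ U j) := by
        by_contra! h
        exact hj (hU (Finset.ext h)).symm
      obtain ⟨p, hp⟩ := this
      rw [Finset.prod_eq_zero (Finset.mem_univ p) (by rw [hgint, if_neg hp]), mul_zero]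
    · simp
  rw [integral_complex_ofReal] at hv
  exact_mod_cast hv

/-- The index set of the monomials of `∑ S, (A.subtensor S).per`. -/
abbrev MonomialIndex (d n k : ℕ) : Type :=
  (Fin d → (Fin k ↪o Fin n)) ×
    {σ : Fin d → Equiv.Perm (Fin k) // ∀ j : Fin d, j.val = 0 → σ j = 1}

theorem card_monomialIndex_mul {d : ℕ} (hd : 0 < d) (n k : ℕ) :
    Fintype.card (MonomialIndex d n k) * k.factorial = n.descFactorial k ^ d := by
  rw [Fintype.card_prod, Fintype.card_subtype, card_normalized_perms hd, ←
    card_orderEmb_mul_factorial, Fintype.card_fun, Fintype.card_fin, mul_pow, mul_assoc]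
  congr 1
  rw [← pow_succ, Nat.sub_add_cancel hd]

/-- The positions of the entries of a monomial. -/
def MonomialIndex.position {d n k : ℕ} (m : MonomialIndex d n k) (i : Fin k) : Fin d → Fin n :=
  fun j => m.1 j (m.2.1 j i)

/-- The set of positions of the entries of a monomial. -/
def MonomialIndex.support {d n k : ℕ} (m : MonomialIndex d n k) : Finset (Fin d → Fin n) :=
  Finset.univ.image m.position

theorem MonomialIndex.position_zero {d n k : ℕ} (hd : 0 < d) (m : MonomialIndex d n k)
    (i : Fin k) : m.position i ⟨0, hd⟩ = m.1 ⟨0, hd⟩ i := by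
  rw [MonomialIndex.position, m.2.2 ⟨0, hd⟩ rfl]
  rfl

theorem MonomialIndex.position_injective {d n k : ℕ} (hd : 0 < d) (m : MonomialIndex d n k) :
    Function.Injective m.position := fun a b hab => by
  have := congrFun hab ⟨0, hd⟩
  rw [m.position_zero hd, m.position_zero hd] at this
  exact (m.1 _).injective this

theorem MonomialIndex.card_support {d n k : ℕ} (hd : 0 < d) (m : MonomialIndex d n k) :
    m.support.card = k := by
  rw [MonomialIndex.support, Finset.card_image_of_injective _ (m.position_injective hd)]
  simp

/-- The first index is not permuted, so sorting the support by first index recovers the order of the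
positions. In every other index the resulting injection splits uniquely into its increasing part and
its permutation. -/
theorem MonomialIndex.support_injective {d n k : ℕ} (hd : 0 < d) :
    Function.Injective (MonomialIndex.support (d := d) (n := n) (k := k)) := by
  intro m m' h
  have key : ∀ (m m' : MonomialIndex d n k), m.support = m'.support → ∀ i, ∃ i',
      m.position i = m'.position i' := by
    intro m m' h i
    have : m.position i ∈ m'.support := by
      rw [← h]; exact Finset.mem_image_of_mem _ (Finset.mem_univ _)
    obtain ⟨i', _, hi'⟩ := Finset.mem_image.1 this
    exact ⟨i', hi'.symm⟩
  have h0 : m.1 ⟨0, hd⟩ = m'.1 ⟨0, hd⟩ := by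
    refine OrderEmbedding.range_inj.1 (Set.ext fun y => ⟨?_, ?_⟩)
    · rintro ⟨i, rfl⟩
      obtain ⟨i', hi'⟩ := key m m' h i
      exact ⟨i', by rw [← m.position_zero hd, hi', m'.position_zero hd]⟩
    · rintro ⟨i, rfl⟩
      obtain ⟨i', hi'⟩ := key m' m h.symm i
      exact ⟨i', by rw [← m'.position_zero hd, hi', m.position_zero hd]⟩
  have hpos : m.position = m'.position := by
    funext i
    obtain ⟨i', hi'⟩ := key m m' h i
    have : i = i' := by
      have := congrFun hi' ⟨0, hd⟩
      rw [m.position_zero hd, m'.position_zero hd, h0] at this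
      exact (m'.1 _).injective this
    rw [hi', ← this]
  have heq : ∀ j, (m.1 j, m.2.1 j) = (m'.1 j, m'.2.1 j) := fun j => by
    apply (orderEmbProdPermEquiv k n).injective
    ext i
    exact congrArg Fin.val (congrFun (congrFun hpos i) j)
  refine Prod.ext (funext fun j => congrArg Prod.fst (heq j))
    (Subtype.ext (funext fun j => congrArg Prod.snd (heq j)))

theorem Tensor.coeff_eq_sum_monomials {d n : ℕ} (hd : 0 < d) (A : Tensor d n) (k : ℕ) :
    A.coeff k = ∑ m : MonomialIndex d n k,
      1 / ((n.descFactorial k : ℂ) ^ (d - 1)) * ∏ p ∈ m.support, A p := by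
  rw [Tensor.coeff, ← Finset.mul_sum, Fintype.sum_prod_type]
  congr 1
  refine Finset.sum_congr rfl fun S _ => ?_
  rw [Tensor.per, Finset.sum_subtype (p := fun σ : Fin d → Equiv.Perm (Fin k) =>
    ∀ j : Fin d, j.val = 0 → σ j = 1) _ (by simp)]
  refine Finset.sum_congr rfl fun σ _ => ?_
  rw [MonomialIndex.support, Finset.prod_image fun a _ b _ h =>
    MonomialIndex.position_injective hd _ h]
  rfl

/-- One orthonormality statement is applied to the monomials of all degrees in `s` at once: supports
of different degrees differ in cardinality, so there are no cross terms between coefficients. -/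
theorem integral_norm_sq_sum_coeff_le {d n : ℕ} (hd : 3 ≤ d) (ν : Measure ℂ)
    [IsProbabilityMeasure ν] {μ : ℂ} (hint : Integrable (fun x => x - μ) ν)
    (hsq : Integrable (fun x => ‖x - μ‖ ^ 2) ν) (hmean : ∫ x, (x - μ) ∂ν = 0)
    (hvar : ∫ x, ‖x - μ‖ ^ 2 ∂ν = 1) (z : ℂ) (s : Finset ℕ) (hs : s ⊆ Finset.Icc 1 n) :
    Integrable (fun R : Tensor d n =>
        ‖∑ k ∈ s, Tensor.coeff (R - μ • Tensor.allOnes d n) k * z ^ k‖ ^ 2) (tensorLaw d n ν) ∧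
      ∫ R : Tensor d n, ‖∑ k ∈ s, Tensor.coeff (R - μ • Tensor.allOnes d n) k * z ^ k‖ ^ 2
        ∂(tensorLaw d n ν) ≤ (∑ k ∈ s, (‖z‖ ^ 2) ^ k / k.factorial) / n := by
  have hd0 : 0 < d := by omega
  let U : (Σ k : s, MonomialIndex d n k) → Finset (Fin d → Fin n) := fun m => m.2.support
  let c : (Σ k : s, MonomialIndex d n k) → ℂ := fun m =>
    z ^ (m.1 : ℕ) * (1 / ((n.descFactorial m.1 : ℂ) ^ (d - 1)))
  have hU : Function.Injective U := by
    rintro ⟨k, m⟩ ⟨k', m'⟩ h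
    have hk : k = k' := Subtype.ext <| by
      rw [← m.card_support hd0, ← m'.card_support hd0]
      exact congrArg Finset.card h
    subst hk
    exact congrArg (Sigma.mk k) (MonomialIndex.support_injective hd0 h)
  have hexp : ∀ R : Tensor d n,
      ∑ k ∈ s, Tensor.coeff (R - μ • Tensor.allOnes d n) k * z ^ k =
        ∑ m, c m * ∏ p ∈ U m, (R p - μ) := by
    intro R
    rw [Fintype.sum_sigma, ← Finset.sum_coe_sort s]
    refine Finset.sum_congr rfl fun k _ => ?_
    rw [Tensor.coeff_eq_sum_monomials hd0, Finset.sum_mul]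
    refine Finset.sum_congr rfl fun m _ => ?_
    simp only [c, U, Pi.sub_apply, Pi.smul_apply, Tensor.allOnes, smul_eq_mul, mul_one]
    ring
  obtain ⟨h1, h2⟩ := integral_norm_sq_sum_monomials ν hint hsq hmean hvar U hU c
  simp_rw [hexp]
  refine ⟨h1, ?_⟩
  rw [tensorLaw, h2, Fintype.sum_sigma, ← Finset.sum_coe_sort s, Finset.sum_div]
  refine Finset.sum_le_sum fun k _ => ?_
  obtain ⟨k, hk⟩ := k
  obtain ⟨hk1, hkn⟩ := Finset.mem_Icc.1 (hs hk)
  simp only [c, norm_mul, norm_pow, norm_div, norm_one, RCLike.norm_natCast, Finset.sum_const,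
    Finset.card_univ, nsmul_eq_mul]
  have hcard : (Fintype.card (MonomialIndex d n k) : ℝ) =
      (n.descFactorial k : ℝ) ^ d / k.factorial := by
    rw [eq_div_iff (by exact_mod_cast k.factorial_ne_zero)]
    exact_mod_cast card_monomialIndex_mul hd0 n k
  have hD : (n : ℝ) ≤ n.descFactorial k := by
    obtain ⟨l, rfl⟩ : ∃ l, k = l + 1 := ⟨k - 1, by omega⟩
    obtain ⟨N, rfl⟩ : ∃ N, n = N + 1 := ⟨n - 1, by omega⟩
    rw [Nat.succ_descFactorial_succ]
    exact_mod_cast Nat.le_mul_of_pos_right _ (Nat.descFactorial_pos.2 (by omega))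
  have hn : (1 : ℝ) ≤ n := by exact_mod_cast hk1.trans hkn
  -- Writing D for the falling factorial, D^d / D^(2(d-1)) = D^(-(d-2)) = D^(-(e+1)); order at least
  -- 3 leaves at least one factor 1/D ≤ 1/n.
  obtain ⟨e, rfl⟩ : ∃ e, d = e + 3 := ⟨d - 3, by omega⟩
  rw [hcard]
  have hDpos : (0 : ℝ) < n.descFactorial k := by linarith
  have hf : (0 : ℝ) < k.factorial := by exact_mod_cast k.factorial_pos
  have : (n.descFactorial k : ℝ) ^ (e + 3) / k.factorial *
      (‖z‖ ^ k * (1 / (n.descFactorial k : ℝ) ^ (e + 3 - 1))) ^ 2 =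
        (‖z‖ ^ 2) ^ k / k.factorial / (n.descFactorial k : ℝ) ^ (e + 1) := by
    rw [show e + 3 - 1 = e + 2 by omega]
    field_simp
    ring
  rw [this]
  gcongr
  calc (n : ℝ) ≤ n.descFactorial k := hD
    _ ≤ (n.descFactorial k : ℝ) ^ (e + 1) := le_self_pow₀ (hn.trans hD) (by omega)

/-! ### From second moments to approximation with high probability -/

theorem Tensor.per_smul {d n : ℕ} (A : Tensor d n) (μ : ℂ) : (μ • A).per = μ ^ n * A.per := by
  simp only [Tensor.per, Pi.smul_apply, smul_eq_mul, Finset.prod_mul_distrib, Finset.prod_const,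
    Finset.card_univ, Fintype.card_fin, Finset.mul_sum]

theorem Tensor.coeff_zero {d n : ℕ} (hd : 0 < d) (A : Tensor d n) : A.coeff 0 = 1 := by
  rw [Tensor.coeff_eq_injSum hd, Tensor.injSum]
  simp

theorem Tensor.per_eq_sum_coeff {d n : ℕ} (hd : 0 < d) (R : Tensor d n) {μ : ℂ} (hμ : μ ≠ 0) :
    R.per = μ ^ n * (n.factorial : ℂ) ^ (d - 1) *
      ∑ k ∈ Finset.range (n + 1),
        Tensor.coeff (R - μ • Tensor.allOnes d n) k * (1 / μ) ^ k := by
  have hn : (n.factorial : ℂ) ≠ 0 := by exact_mod_cast n.factorial_ne_zero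
  have hR : R = μ • (Tensor.allOnes d n + (1 / μ) • (R - μ • Tensor.allOnes d n)) := by
    funext i
    simp only [Pi.smul_apply, Pi.add_apply, Pi.sub_apply, smul_eq_mul]
    field_simp
    ring
  rw [← Tensor.per_allOnes_add_smul hd]
  conv_lhs => rw [hR, Tensor.per_smul]
  field_simp

/-- Chebyshev's inequality in the form used for the whole sum and for the tail. -/
theorem measureReal_norm_ge_le {Ω : Type*} [MeasurableSpace Ω] {P : Measure Ω} {f : Ω → ℂ}
    (hf : Integrable (fun x => ‖f x‖ ^ 2) P) {b t : ℝ} (ht : 0 < t)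
    (hb : ∫ x, ‖f x‖ ^ 2 ∂P ≤ b * t ^ 2) : P.real {x | t ≤ ‖f x‖} ≤ b := by
  have h := mul_meas_ge_le_integral_of_nonneg (μ := P) (f := fun x => ‖f x‖ ^ 2)
    (Eventually.of_forall fun x => by positivity) hf (t ^ 2)
  have hset : {x | t ^ 2 ≤ ‖f x‖ ^ 2} = {x | t ≤ ‖f x‖} := by
    ext x
    simp only [Set.mem_ofPred_eq]
    exact pow_le_pow_iff_left₀ ht.le (norm_nonneg _) two_ne_zero
  rw [hset] at h
  have : t ^ 2 * P.real {x | t ≤ ‖f x‖} ≤ t ^ 2 * b := by linarith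
  exact le_of_mul_le_mul_left this (by positivity)

theorem sum_pow_div_factorial_le_exp {x : ℝ} (hx : 0 ≤ x) (s : Finset ℕ) :
    ∑ k ∈ s, x ^ k / k.factorial ≤ Real.exp x := by
  rw [Real.exp_eq_exp_ℝ, NormedSpace.exp_eq_tsum_div]
  exact (Real.summable_pow_div_factorial x).sum_le_tsum s fun k _ => by positivity

namespace IsEntryDistribution

variable {ν : Measure ℂ} {μ : ℂ} {ρ : ℝ}

theorem integrable_sq (h : IsEntryDistribution ν μ ρ) : Integrable (fun x => ‖x - μ‖ ^ 2) ν := by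
  have := h.isProbabilityMeasure
  refine Integrable.mono' ((integrable_const (1 : ℝ)).add h.integrable_third) (by fun_prop)
    (Eventually.of_forall fun x => ?_)
  rw [Real.norm_of_nonneg (by positivity)]
  simp only [Pi.add_apply]
  rcases le_total ‖x - μ‖ 1 with h1 | h1
  · have := pow_le_one₀ (norm_nonneg (x - μ)) h1 (n := 2)
    have := pow_nonneg (norm_nonneg (x - μ)) 3
    linarith
  · have := pow_le_pow_right₀ h1 (show 2 ≤ 3 by norm_num)
    linarith

theorem integrable_sub (h : IsEntryDistribution ν μ ρ) : Integrable (fun x => x - μ) ν := by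
  have := h.isProbabilityMeasure
  refine Integrable.mono' ((integrable_const (1 : ℝ)).add h.integrable_sq) (by fun_prop)
    (Eventually.of_forall fun x => ?_)
  simp only [Pi.add_apply]
  nlinarith [sq_nonneg (‖x - μ‖ - 1), norm_nonneg (x - μ)]

theorem integral_sub (h : IsEntryDistribution ν μ ρ) : ∫ x, (x - μ) ∂ν = 0 := by
  have := h.isProbabilityMeasure
  have hi : Integrable (fun x : ℂ => x) ν := by
    refine (h.integrable_sub.add (integrable_const μ)).congr (Eventually.of_forall fun x => ?_)
    simp
  rw [MeasureTheory.integral_sub hi (integrable_const μ), h.mean]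
  simp

end IsEntryDistribution

/-- The truncated expansion is within a factor `1 ± ε` of the permanent with high probability. -/
theorem tensorLaw_bad_le {d n : ℕ} (hd : 3 ≤ d) (hn : 2 ≤ n) {ν : Measure ℂ} {μ : ℂ} {ρ : ℝ}
    (hν : IsEntryDistribution ν μ ρ) (hμ : μ ≠ 0) {ε : ℝ} (hε : 0 < ε) (hε1 : ε < 1) :
    (tensorLaw d n ν).real {R | ¬ (R.per ≠ 0 ∧ ‖1 - R.truncatedPer μ ε / R.per‖ ≤ ε)} ≤
      8 * Real.exp (Real.exp 2 * ‖1 / μ‖ ^ 2) / n := by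
  have := hν.isProbabilityMeasure
  have hprob : IsProbabilityMeasure (tensorLaw d n ν) := by
    unfold tensorLaw; infer_instance
  have hd0 : 0 < d := by omega
  have hnR : (2 : ℝ) ≤ n := by exact_mod_cast hn
  set z := 1 / μ with hz
  set a : Tensor d n → ℕ → ℂ := fun R k => Tensor.coeff (R - μ • Tensor.allOnes d n) k * z ^ k
  set L := Real.log (n / ε) with hL
  have hLpos : 0 < L := Real.log_pos (by rw [lt_div_iff₀ hε]; linarith)
  set s := (Finset.range (n + 1)).filter (fun k : ℕ => ¬ (k : ℝ) ≤ L) with hs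
  have hs1 : s ⊆ Finset.Icc 1 n := by
    intro k hk
    simp only [hs, Finset.mem_filter, Finset.mem_range] at hk
    rw [Finset.mem_Icc]
    refine ⟨Nat.one_le_iff_ne_zero.2 ?_, by omega⟩
    rintro rfl
    exact hk.2 (by simpa using hLpos.le)
  have hmom := integral_norm_sq_sum_coeff_le (n := n) hd ν hν.integrable_sub hν.integrable_sq
    hν.integral_sub hν.variance z
  have hx : ‖z‖ ^ 2 ≤ Real.exp 2 * ‖z‖ ^ 2 :=
    le_mul_of_one_le_left (by positivity) (Real.one_le_exp (by norm_num))
  -- The factor e² is needed only for the tail; this larger exponential serves both estimates.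
  set E := Real.exp (Real.exp 2 * ‖z‖ ^ 2) with hE
  have hP1 : (tensorLaw d n ν).real {R | 1 / 2 ≤ ‖∑ k ∈ Finset.Icc 1 n, a R k‖} ≤ 4 * E / n := by
    obtain ⟨h1, h2⟩ := hmom (Finset.Icc 1 n) subset_rfl
    refine measureReal_norm_ge_le h1 (by norm_num) (h2.trans ?_)
    have : ∑ k ∈ Finset.Icc 1 n, (‖z‖ ^ 2) ^ k / k.factorial ≤ E :=
      (sum_pow_div_factorial_le_exp (by positivity) _).trans (Real.exp_le_exp.2 hx)
    calc _ ≤ E / n := by gcongr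
      _ = _ := by ring
  have hP2 : (tensorLaw d n ν).real {R | ε / 2 ≤ ‖∑ k ∈ s, a R k‖} ≤ 4 * E / n := by
    obtain ⟨h1, h2⟩ := hmom s hs1
    refine measureReal_norm_ge_le h1 (by positivity) (h2.trans ?_)
    have : ∑ k ∈ s, (‖z‖ ^ 2) ^ k / k.factorial ≤ ε ^ 2 * E := by
      calc ∑ k ∈ s, (‖z‖ ^ 2) ^ k / k.factorial
          ≤ ∑ k ∈ s, ε ^ 2 * ((Real.exp 2 * ‖z‖ ^ 2) ^ k / k.factorial) := by
            refine Finset.sum_le_sum fun k hk => ?_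
            simp only [hs, Finset.mem_filter, not_le] at hk
            have h3 : n / ε < Real.exp k := by
              rw [← Real.log_lt_iff_lt_exp (by positivity)]; exact hk.2
            have h4 : 1 ≤ ε * Real.exp k := by
              rw [div_lt_iff₀ hε] at h3; linarith
            -- The weight inserted into the tail: its ε² cancels the squared threshold (ε/2)², and
            -- its e^(2k) is absorbed into the exponential series.
            have h5 : 1 ≤ ε ^ 2 * Real.exp 2 ^ k := by
              have : Real.exp 2 ^ k = Real.exp k ^ 2 := by
                rw [← Real.exp_nat_mul, ← Real.exp_nat_mul]; congr 1; push_cast; ring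
              rw [this, ← mul_pow]
              exact one_le_pow₀ h4
            calc (‖z‖ ^ 2) ^ k / k.factorial
                ≤ (ε ^ 2 * Real.exp 2 ^ k) * ((‖z‖ ^ 2) ^ k / k.factorial) :=
                  le_mul_of_one_le_left (by positivity) h5
              _ = _ := by rw [mul_pow (Real.exp 2)]; ring
        _ ≤ ε ^ 2 * E := by
            rw [← Finset.mul_sum]
            gcongr
            exact sum_pow_div_factorial_le_exp (by positivity) _
    calc _ ≤ ε ^ 2 * E / n := by gcongr
      _ = _ := by ring
  have hsub : {R | ¬ (R.per ≠ 0 ∧ ‖1 - R.truncatedPer μ ε / R.per‖ ≤ ε)} ⊆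
      {R : Tensor d n | 1 / 2 ≤ ‖∑ k ∈ Finset.Icc 1 n, a R k‖} ∪
        {R | ε / 2 ≤ ‖∑ k ∈ s, a R k‖} := by
    intro R hR
    by_contra hcon
    simp only [Set.mem_union, Set.mem_ofPred_eq, not_or, not_le] at hcon
    obtain ⟨c1, c2⟩ := hcon
    apply hR
    set q := μ ^ n * (n.factorial : ℂ) ^ (d - 1) with hq
    have hq0 : q ≠ 0 := mul_ne_zero (pow_ne_zero _ hμ)
      (pow_ne_zero _ (by exact_mod_cast n.factorial_ne_zero))
    set S := ∑ k ∈ Finset.range (n + 1), a R k with hS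
    have hper : R.per = q * S := Tensor.per_eq_sum_coeff hd0 R hμ
    have htr : R.truncatedPer μ ε =
        q * ∑ k ∈ (Finset.range (n + 1)).filter (fun k : ℕ => (k : ℝ) ≤ L), a R k := rfl
    have hS1 : S = 1 + ∑ k ∈ Finset.Icc 1 n, a R k := by
      rw [hS, Finset.range_eq_Ico, Finset.sum_eq_sum_Ico_succ_bot (by omega)]
      congr 1
      simp only [a, Tensor.coeff_zero hd0, pow_zero, mul_one]
    have hS2 : ∑ k ∈ (Finset.range (n + 1)).filter (fun k : ℕ => (k : ℝ) ≤ L), a R k =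
        S - ∑ k ∈ s, a R k := by
      rw [hS, hs, ← Finset.sum_filter_add_sum_filter_not (Finset.range (n + 1))
        (fun k : ℕ => (k : ℝ) ≤ L)]
      ring
    have hSn : 1 / 2 ≤ ‖S‖ := by
      have := norm_sub_le S (∑ k ∈ Finset.Icc 1 n, a R k)
      rw [hS1, add_sub_cancel_right, norm_one, ← hS1] at this
      linarith
    have hS0 : S ≠ 0 := norm_pos_iff.1 (by linarith)
    refine ⟨hper ▸ mul_ne_zero hq0 hS0, ?_⟩
    rw [htr, hper, mul_div_mul_left _ _ hq0, hS2, sub_div, div_self hS0, sub_sub_cancel, norm_div,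
      div_le_iff₀ (by linarith)]
    -- The relative error is |tail| / |S|, with |tail| < ε/2 ≤ ε|S|.
    nlinarith
  calc _ ≤ _ := measureReal_mono hsub
    _ ≤ _ := measureReal_union_le _ _
    _ ≤ 4 * E / n + 4 * E / n := add_le_add hP1 hP2
    _ = _ := by ring

/-- Because 2c < 1, the exponent e² (ln n)^(2c) is eventually at most (ln n)/2, which leaves a bound
of 8 n^(-1/2). -/
theorem eventually_exp_log_rpow_div_le {c : ℝ} (hc : c < 1 / 8) {δ : ℝ} (hδ : 0 < δ) :
    ∀ᶠ n : ℕ in atTop,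
      8 * Real.exp (Real.exp 2 * (Real.log n ^ c) ^ 2) / n ≤ δ := by
  have hlog : Tendsto (fun n : ℕ => Real.log n) atTop atTop :=
    Real.tendsto_log_atTop.comp tendsto_natCast_atTop_atTop
  have h1 : ∀ᶠ x : ℝ in atTop, Real.exp 2 * (x ^ c) ^ 2 ≤ x / 2 := by
    have ho := (tendsto_rpow_neg_atTop (show 0 < 1 - 2 * c by linarith)).eventually
      (gt_mem_nhds (show 0 < 1 / (2 * Real.exp 2) by positivity))
    filter_upwards [ho, eventually_gt_atTop 0] with x hx hx0
    replace hx : x ^ (2 * c) ≤ 1 / (2 * Real.exp 2) * x := by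
      calc x ^ (2 * c) = x ^ (-(1 - 2 * c)) * x := by
            rw [← Real.rpow_add_one hx0.ne']; congr 1; ring
        _ ≤ _ := by gcongr
    have : (x ^ c) ^ 2 = x ^ (2 * c) := by
      rw [← Real.rpow_natCast, ← Real.rpow_mul hx0.le]; congr 1; push_cast; ring
    rw [this]
    calc _ ≤ Real.exp 2 * (1 / (2 * Real.exp 2) * x) := by gcongr
      _ = x / 2 := by field_simp
  have h2 : ∀ᶠ x : ℝ in atTop, 8 * Real.exp (-(x / 2)) ≤ δ := by
    have : Tendsto (fun x : ℝ => 8 * Real.exp (-(x / 2))) atTop (nhds (8 * 0)) :=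
      ((Real.tendsto_exp_neg_atTop_nhds_zero).comp
        (tendsto_id.atTop_div_const (by norm_num : (0 : ℝ) < 2))).const_mul 8
    rw [mul_zero] at this
    filter_upwards [this.eventually (gt_mem_nhds hδ)] with x hx using hx.le
  filter_upwards [hlog.eventually h1, hlog.eventually h2, eventually_ge_atTop 1] with n h1 h2 hn
  have hn0 : (0 : ℝ) < n := by exact_mod_cast hn
  refine le_trans ?_ h2
  rw [mul_div_assoc]
  gcongr
  rw [div_le_iff₀ hn0]
  calc _ ≤ Real.exp (Real.log n / 2) := Real.exp_le_exp.2 h1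
    _ = Real.exp (-(Real.log n / 2)) * Real.exp (Real.log n) := by
      rw [← Real.exp_add]; congr 1; ring
    _ = _ := by rw [Real.exp_log hn0]

theorem eventually_tensorLaw_bad_le {c : ℝ} (hc₀ : 0 < c) (hc₁ : c < 1 / 8) (d : ℕ → ℕ)
    (hd : ∀ n, 3 ≤ d n) (ρ : ℝ) {δ : ℝ} (hδ : 0 < δ) :
    ∀ᶠ n : ℕ in atTop, ∀ (μ : ℂ) (ν : Measure ℂ), IsEntryDistribution ν μ ρ →
      (Real.log n / ((d n : ℝ) - 1) ^ 6) ^ (-c) ≤ ‖μ‖ → ∀ ε : ℝ, 0 < ε → ε < 1 →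
        μ ≠ 0 ∧ 2 ≤ n ∧
        tensorLaw (d n) n ν {R | ¬ (R.per ≠ 0 ∧ ‖1 - R.truncatedPer μ ε / R.per‖ ≤ ε)} ≤
          ENNReal.ofReal δ := by
  filter_upwards [eventually_exp_log_rpow_div_le hc₁ hδ, eventually_ge_atTop 2] with n hn hn2
  intro μ ν hν hμ ε hε hε1
  have := hν.isProbabilityMeasure
  have hprob : IsProbabilityMeasure (tensorLaw (d n) n ν) := by
    unfold tensorLaw; infer_instance
  have hlog : 0 < Real.log n := Real.log_pos (by exact_mod_cast hn2)
  -- Dividing by (d - 1)^6 ≥ 1 only decreases the base, so |1/μ| ≤ (ln n)^c whatever the order.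
  have hd1 : (1 : ℝ) ≤ ((d n : ℝ) - 1) ^ 6 := by
    have : (3 : ℝ) ≤ d n := by exact_mod_cast hd n
    exact one_le_pow₀ (by linarith)
  set x := Real.log n / ((d n : ℝ) - 1) ^ 6 with hx
  have hx0 : 0 < x := by positivity
  have hxc : 0 < x ^ c := Real.rpow_pos_of_pos hx0 c
  rw [Real.rpow_neg hx0.le] at hμ
  have hμ0 : μ ≠ 0 := norm_pos_iff.1 (lt_of_lt_of_le (inv_pos.2 hxc) hμ)
  have hz : ‖1 / μ‖ ≤ Real.log n ^ c := by
    rw [norm_div, norm_one, one_div]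
    calc ‖μ‖⁻¹ ≤ ((x ^ c)⁻¹)⁻¹ := inv_anti₀ (inv_pos.2 hxc) hμ
      _ = x ^ c := inv_inv _
      _ ≤ _ := Real.rpow_le_rpow hx0.le (div_le_self hlog.le hd1) hc₀.le
  refine ⟨hμ0, hn2, ?_⟩
  rw [← ofReal_measureReal]
  refine ENNReal.ofReal_le_ofReal ((tensorLaw_bad_le (hd n) hn2 hν hμ0 hε hε1).trans
    (le_trans ?_ hn))
  gcongr

/-! ### Computations in polynomial time -/

@[simp] theorem Store.setIdx_idx (s : Store) (i v j : ℕ) :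
    (s.setIdx i v).idx j = if j = i then v else s.idx j := by
  simp [Store.setIdx, Function.update_apply]

@[simp] theorem Store.setIdx_num (s : Store) (i v j : ℕ) : (s.setIdx i v).num j = s.num j := rfl

@[simp] theorem Store.setNum_idx (s : Store) (i : ℕ) (v : ℂ) (j : ℕ) :
    (s.setNum i v).idx j = s.idx j := rfl

@[simp] theorem Store.setNum_num (s : Store) (i : ℕ) (v : ℂ) (j : ℕ) :
    (s.setNum i v).num j = if j = i then v else s.num j := by
  simp [Store.setNum, Function.update_apply]

/-- The cells with numbers below `r` have the same content. -/
def Store.AgreeBelow (r : ℕ) (s s' : Store) : Prop :=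
  ∀ j < r, s'.idx j = s.idx j ∧ s'.num j = s.num j

theorem Store.AgreeBelow.refl (r : ℕ) (s : Store) : Store.AgreeBelow r s s :=
  fun _ _ => ⟨rfl, rfl⟩

theorem Store.AgreeBelow.trans {r : ℕ} {s s' s'' : Store} (h : Store.AgreeBelow r s s')
    (h' : Store.AgreeBelow r s' s'') : Store.AgreeBelow r s s'' := fun j hj =>
  ⟨(h' j hj).1.trans (h j hj).1, (h' j hj).2.trans (h j hj).2⟩

theorem Store.AgreeBelow.mono {r r' : ℕ} (hr : r ≤ r') {s s' : Store}
    (h : Store.AgreeBelow r' s s') : Store.AgreeBelow r s s' := fun j hj => h j (hj.trans_le hr)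

theorem Store.AgreeBelow.setIdx {r i : ℕ} (h : r ≤ i) (s : Store) (v : ℕ) :
    Store.AgreeBelow r s (s.setIdx i v) := fun j hj => by
  simp [show j ≠ i by omega]

theorem Store.AgreeBelow.setNum {r i : ℕ} (h : r ≤ i) (s : Store) (v : ℂ) :
    Store.AgreeBelow r s (s.setNum i v) := fun j hj => by
  simp [show j ≠ i by omega]

/-- Lets time bounds of the form W^C absorb sums and additive constants, so that no coefficients
need tracking. -/
theorem pow_add_pow_le_pow_of_two_le {W : ℕ} (hW : 2 ≤ W) (a b : ℕ) :
    W ^ a + W ^ b ≤ W ^ (a + b + 1) := by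
  have ha : W ^ a ≤ W ^ (a + b) := Nat.pow_le_pow_right (by omega) (by omega)
  have hb : W ^ b ≤ W ^ (a + b) := Nat.pow_le_pow_right (by omega) (by omega)
  calc W ^ a + W ^ b ≤ W ^ (a + b) * 2 := by omega
    _ ≤ W ^ (a + b) * W := Nat.mul_le_mul_left _ hW
    _ = _ := (pow_succ _ _).symm

theorem le_pow_self_of_two_le {W : ℕ} (hW : 2 ≤ W) (a : ℕ) : a ≤ W ^ a :=
  (Nat.lt_pow_self (by omega)).le

/-- A family of computation tasks with parameters `x : X`: the input array, the size to which running
times are compared, and the condition that a memory represents `x`, which concerns only the cells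
below `depth`. -/
structure Ctx (X : Type) where
  /-- the input array -/
  inp : X → ℕ → ℂ
  /-- the size -/
  size : X → ℕ
  two_le_size : ∀ x, 2 ≤ size x
  /-- the number of cells in use -/
  depth : ℕ
  /-- the memory represents the parameter -/
  rep : X → Store → Prop
  rep_congr : ∀ {x s s'}, Store.AgreeBelow depth s s' → rep x s → rep x s'

namespace Ctx

variable {X : Type} (Γ : Ctx X)

/-- Some program passes in polynomial time from memories that satisfy `pre` to memories that satisfy
`post`, and does not change the cells below `r`. -/
def Hoare (r : ℕ) (pre post : X → Store → Prop) : Prop :=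
  ∃ (p : Program) (C : ℕ), ∀ x s, Γ.rep x s → pre x s → ∃ s' T, Program.Runs (Γ.inp x) p s s' T ∧
    Store.AgreeBelow r s s' ∧ post x s' ∧ T ≤ Γ.size x ^ C

/-- `f` can be computed in polynomial time, the value being put into any cell not in use. -/
def Computes {α : Type} (get : Store → ℕ → α) (f : X → α) : Prop :=
  ∀ r, Γ.depth ≤ r → Γ.Hoare r (fun _ _ => True) (fun x s => get s r = f x)

/-- `f` is bounded by a power of the size. -/
def Bounded (f : X → ℕ) : Prop := ∃ C, ∀ x s, Γ.rep x s → f x ≤ Γ.size x ^ C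

/-- `f` is a polynomially bounded natural number computable in polynomial time. -/
def NatC (f : X → ℕ) : Prop := Γ.Computes Store.idx f ∧ Γ.Bounded f

/-- `f` is a complex number computable in polynomial time. -/
def NumC (f : X → ℂ) : Prop := Γ.Computes Store.num f

variable {Γ} {r : ℕ}

theorem Hoare.seq {a b c : X → Store → Prop} (hr : Γ.depth ≤ r) (h₁ : Γ.Hoare r a b)
    (h₂ : Γ.Hoare r b c) : Γ.Hoare r a c := by
  obtain ⟨p, C, hp⟩ := h₁
  obtain ⟨q, D, hq⟩ := h₂
  refine ⟨.seq p q, C + D + 1, fun x s hs ha => ?_⟩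
  obtain ⟨s', T, h1, h2, h3, h4⟩ := hp x s hs ha
  obtain ⟨s'', T', k1, k2, k3, k4⟩ := hq x s' (Γ.rep_congr (h2.mono hr) hs) h3
  exact ⟨s'', T + T', .seq h1 k1, h2.trans k2, k3,
    (Nat.add_le_add h4 k4).trans (pow_add_pow_le_pow_of_two_le (Γ.two_le_size x) C D)⟩

theorem Hoare.instr {pre post : X → Store → Prop} (a : Instr)
    (h : ∀ x s, Γ.rep x s → pre x s →
      Store.AgreeBelow r s (a.exec (Γ.inp x) s) ∧ post x (a.exec (Γ.inp x) s)) :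
    Γ.Hoare r pre post :=
  ⟨.instr a, 0, fun x s hs ha => ⟨_, 1, .instr a s, (h x s hs ha).1, (h x s hs ha).2, by simp⟩⟩

theorem Hoare.mono {r' : ℕ} (hr : r ≤ r') {pre post pre' post' : X → Store → Prop}
    (hpre : ∀ x s, Γ.rep x s → pre' x s → pre x s) (hpost : ∀ x s, post x s → post' x s)
    (h : Γ.Hoare r' pre post) : Γ.Hoare r pre' post' := by
  obtain ⟨p, C, hp⟩ := h
  refine ⟨p, C, fun x s hs ha => ?_⟩
  obtain ⟨s', T, h1, h2, h3, h4⟩ := hp x s hs (hpre x s hs ha)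
  exact ⟨s', T, h1, h2.mono hr, hpost x s' h3, h4⟩

/-- A property of the cells which a program does not change is preserved. -/
theorem Hoare.frame {F pre post : X → Store → Prop} (h : Γ.Hoare r pre post)
    (hF : ∀ x s s', Store.AgreeBelow r s s' → F x s → F x s') :
    Γ.Hoare r (fun x s => F x s ∧ pre x s) (fun x s => F x s ∧ post x s) := by
  obtain ⟨p, C, hp⟩ := h
  refine ⟨p, C, fun x s hs ha => ?_⟩
  obtain ⟨s', T, h1, h2, h3, h4⟩ := hp x s hs ha.2
  exact ⟨s', T, h1, h2, ⟨hF x s s' h2 ha.1, h3⟩, h4⟩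

theorem Hoare.ite {pre post : X → Store → Prop} (b : Test)
    (h₁ : Γ.Hoare r (fun x s => pre x s ∧ b.Holds s) post)
    (h₂ : Γ.Hoare r (fun x s => pre x s ∧ ¬ b.Holds s) post) : Γ.Hoare r pre post := by
  obtain ⟨p, C, hp⟩ := h₁
  obtain ⟨q, D, hq⟩ := h₂
  refine ⟨.ite b p q, C + D + 1, fun x s hs ha => ?_⟩
  have hsum := pow_add_pow_le_pow_of_two_le (Γ.two_le_size x) C D
  have h1 : 1 ≤ Γ.size x ^ C := Nat.one_le_pow _ _ (by have := Γ.two_le_size x; omega)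
  have h1' : 1 ≤ Γ.size x ^ D := Nat.one_le_pow _ _ (by have := Γ.two_le_size x; omega)
  by_cases hb : b.Holds s
  · obtain ⟨s', T, h1, h2, h3, h4⟩ := hp x s hs ⟨ha, hb⟩
    exact ⟨s', T + 1, .iteTrue hb h1, h2, h3, by omega⟩
  · obtain ⟨s', T, h1, h2, h3, h4⟩ := hq x s hs ⟨ha, hb⟩
    exact ⟨s', T + 1, .iteFalse hb h1, h2, h3, by omega⟩

/-- Evaluate one subexpression into cell `r`, a second one into cell `r + 1`. -/
theorem Hoare.pair {α β : Type} {get : Store → ℕ → α} {get' : Store → ℕ → β}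
    (hget : ∀ r s s', Store.AgreeBelow (r + 1) s s' → get s' r = get s r)
    {f : X → α} {g : X → β} (hf : Γ.Computes get f) (hg : Γ.Computes get' g)
    (hr : Γ.depth ≤ r) :
    Γ.Hoare r (fun _ _ => True) (fun x s => get s r = f x ∧ get' s (r + 1) = g x) := by
  refine (hf r hr).seq hr ?_
  refine Hoare.mono (Nat.le_succ r) (fun x s _ h => ⟨h, trivial⟩) (fun x s h => h)
    ((hg (r + 1) (by omega)).frame (F := fun x s => get s r = f x) ?_)
  intro x s s' h h'
  rw [hget r s s' h, h']

theorem idx_congr (r : ℕ) (s s' : Store) (h : Store.AgreeBelow (r + 1) s s') :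
    s'.idx r = s.idx r := (h r (Nat.lt_succ_self r)).1

theorem num_congr (r : ℕ) (s s' : Store) (h : Store.AgreeBelow (r + 1) s s') :
    s'.num r = s.num r := (h r (Nat.lt_succ_self r)).2

theorem Computes.congr {α : Type} {get : Store → ℕ → α} {f g : X → α} (h : Γ.Computes get f)
    (hfg : ∀ x s, Γ.rep x s → f x = g x) : Γ.Computes get g := fun r hr => by
  obtain ⟨p, C, hp⟩ := h r hr
  refine ⟨p, C, fun x s hs ha => ?_⟩
  obtain ⟨s', T, h1, h2, h3, h4⟩ := hp x s hs ha
  exact ⟨s', T, h1, h2, h3.trans (hfg x s hs), h4⟩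

theorem NatC.congr {f g : X → ℕ} (h : Γ.NatC f) (hfg : ∀ x s, Γ.rep x s → f x = g x) :
    Γ.NatC g := by
  refine ⟨h.1.congr hfg, ?_⟩
  obtain ⟨C, hC⟩ := h.2
  exact ⟨C, fun x s hs => hfg x s hs ▸ hC x s hs⟩

theorem NumC.congr {f g : X → ℂ} (h : Γ.NumC f) (hfg : ∀ x s, Γ.rep x s → f x = g x) :
    Γ.NumC g := Computes.congr h hfg

theorem NatC.const (v : ℕ) : Γ.NatC fun _ => v :=
  ⟨fun r _ => .instr (.idxConst r v) fun x s _ _ =>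
    ⟨.setIdx le_rfl _ _, by simp [Instr.exec]⟩,
    v, fun x _ _ => le_pow_self_of_two_le (Γ.two_le_size x) v⟩

theorem NatC.add {f g : X → ℕ} (hf : Γ.NatC f) (hg : Γ.NatC g) : Γ.NatC fun x => f x + g x := by
  refine ⟨fun r hr => (Hoare.pair idx_congr hf.1 hg.1 hr).seq hr
    (.instr (.idxAdd r r (r + 1)) fun x s _ h => ⟨.setIdx le_rfl _ _, by simp [Instr.exec, h]⟩), ?_⟩
  obtain ⟨C, hC⟩ := hf.2
  obtain ⟨D, hD⟩ := hg.2
  exact ⟨C + D + 1, fun x s hs => (Nat.add_le_add (hC x s hs) (hD x s hs)).trans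
    (pow_add_pow_le_pow_of_two_le (Γ.two_le_size x) C D)⟩

theorem NatC.sub {f g : X → ℕ} (hf : Γ.NatC f) (hg : Γ.NatC g) : Γ.NatC fun x => f x - g x := by
  refine ⟨fun r hr => (Hoare.pair idx_congr hf.1 hg.1 hr).seq hr
    (.instr (.idxSub r r (r + 1)) fun x s _ h => ⟨.setIdx le_rfl _ _, by simp [Instr.exec, h]⟩), ?_⟩
  obtain ⟨C, hC⟩ := hf.2
  exact ⟨C, fun x s hs => (Nat.sub_le _ _).trans (hC x s hs)⟩

theorem NumC.const (v : ℂ) : Γ.NumC fun _ => v := fun r _ =>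
  .instr (.numConst r v) fun x s _ _ => ⟨.setNum le_rfl _ _, by simp [Instr.exec]⟩

theorem NumC.add {f g : X → ℂ} (hf : Γ.NumC f) (hg : Γ.NumC g) : Γ.NumC fun x => f x + g x :=
  fun r hr => (Hoare.pair num_congr hf hg hr).seq hr
    (.instr (.numAdd r r (r + 1)) fun x s _ h => ⟨.setNum le_rfl _ _, by simp [Instr.exec, h]⟩)

theorem NumC.sub {f g : X → ℂ} (hf : Γ.NumC f) (hg : Γ.NumC g) : Γ.NumC fun x => f x - g x :=
  fun r hr => (Hoare.pair num_congr hf hg hr).seq hr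
    (.instr (.numSub r r (r + 1)) fun x s _ h => ⟨.setNum le_rfl _ _, by simp [Instr.exec, h]⟩)

theorem NumC.mul {f g : X → ℂ} (hf : Γ.NumC f) (hg : Γ.NumC g) : Γ.NumC fun x => f x * g x :=
  fun r hr => (Hoare.pair num_congr hf hg hr).seq hr
    (.instr (.numMul r r (r + 1)) fun x s _ h => ⟨.setNum le_rfl _ _, by simp [Instr.exec, h]⟩)

theorem NumC.div {f g : X → ℂ} (hf : Γ.NumC f) (hg : Γ.NumC g) : Γ.NumC fun x => f x / g x :=
  fun r hr => (Hoare.pair num_congr hf hg hr).seq hr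
    (.instr (.numDiv r r (r + 1)) fun x s _ h => ⟨.setNum le_rfl _ _, by simp [Instr.exec, h]⟩)

theorem NumC.input {f : X → ℕ} (hf : Γ.NatC f) : Γ.NumC fun x => Γ.inp x (f x) := fun r hr =>
  (hf.1 r hr).seq hr
    (.instr (.input r r) fun x s _ h => ⟨.setNum le_rfl _ _, by simp [Instr.exec, h]⟩)

open Classical in
theorem NatC.numLe {f g : X → ℂ} (hf : Γ.NumC f) (hg : Γ.NumC g) :
    Γ.NatC fun x => if (f x).re ≤ (g x).re then 1 else 0 := by
  refine ⟨fun r hr => (Hoare.pair num_congr hf hg hr).seq hr (.ite (.numLe r (r + 1))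
    (.instr (.idxConst r 1) fun x s _ h => ⟨.setIdx le_rfl _ _, ?_⟩)
    (.instr (.idxConst r 0) fun x s _ h => ⟨.setIdx le_rfl _ _, ?_⟩)), 0, fun x s _ => ?_⟩
  · obtain ⟨⟨h1, h2⟩, h3⟩ := h
    simp only [Test.Holds, h1, h2] at h3
    simp [Instr.exec, h3]
  · obtain ⟨⟨h1, h2⟩, h3⟩ := h
    simp only [Test.Holds, h1, h2] at h3
    simp [Instr.exec, h3]
  · dsimp only
    split_ifs <;> simp

/-! #### Loops -/

/-- `Δ` arises from `Γ` by adding a natural number below `b` to the parameters. -/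
structure Extends (Δ : Ctx (X × ℕ)) (Γ : Ctx X) (b : X → ℕ) : Prop where
  inp : ∀ y, Δ.inp y = Γ.inp y.1
  size : ∀ y, Δ.size y = Γ.size y.1
  depth : Γ.depth ≤ Δ.depth
  rep : ∀ y s, Δ.rep y s → Γ.rep y.1 s
  lt : ∀ y s, Δ.rep y s → y.2 < b y.1
  var : Δ.NatC Prod.snd

/-- The same program serves: its working cells lie beyond the depth of `Δ`, hence beyond that of
`Γ`. -/
theorem Extends.computes {Δ : Ctx (X × ℕ)} {b : X → ℕ} (h : Δ.Extends Γ b) {α : Type}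
    {get : Store → ℕ → α} {f : X → α} (hf : Γ.Computes get f) :
    Δ.Computes get fun y => f y.1 := fun r hr => by
  obtain ⟨p, C, hp⟩ := hf r (h.depth.trans hr)
  refine ⟨p, C, fun y s hs ha => ?_⟩
  rw [h.inp, h.size]
  exact hp y.1 s (h.rep y s hs) ha

theorem Extends.natC {Δ : Ctx (X × ℕ)} {b : X → ℕ} (h : Δ.Extends Γ b) {f : X → ℕ}
    (hf : Γ.NatC f) : Δ.NatC fun y => f y.1 := by
  refine ⟨h.computes hf.1, ?_⟩
  obtain ⟨C, hC⟩ := hf.2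
  exact ⟨C, fun y s hs => by rw [h.size]; exact hC y.1 s (h.rep y s hs)⟩

theorem Extends.numC {Δ : Ctx (X × ℕ)} {b : X → ℕ} (h : Δ.Extends Γ b) {f : X → ℂ}
    (hf : Γ.NumC f) : Δ.NumC fun y => f y.1 := h.computes hf

/-- The two kinds of memory. -/
structure IsMemory {α : Type} (get : Store → ℕ → α) : Prop where
  congr : ∀ r s s', Store.AgreeBelow (r + 1) s s' → get s' r = get s r
  /-- the content of a cell can be copied -/
  copy : ∀ r r' : ℕ, ∃ q : Program, ∀ inp s, ∃ s', Program.Runs inp q s s' 2 ∧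
    get s' r = get s r' ∧ Store.AgreeBelow r s s' ∧ ∀ j < r', j ≠ r → s'.idx j = s.idx j

/-- In the absence of a copy instruction, zero is added from the scratch cell `r + r' + 1`, which
lies beyond both cells. -/
theorem isMemory_idx : IsMemory Store.idx where
  congr := idx_congr
  copy r r' := ⟨.seq (.instr (.idxConst (r + r' + 1) 0)) (.instr (.idxAdd r r' (r + r' + 1))),
    fun inp s => ⟨_, .seq (.instr _ _) (.instr _ _), by simp [Instr.exec, show r' ≠ r + r' + 1 by omega],
      (Store.AgreeBelow.setIdx (by omega) _ _).trans (.setIdx le_rfl _ _), fun j hj hne => by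
        simp [Instr.exec, hne, show j ≠ r + r' + 1 by omega]⟩⟩

theorem isMemory_num : IsMemory Store.num where
  congr := num_congr
  copy r r' := ⟨.seq (.instr (.numConst (r + r' + 1) 0)) (.instr (.numAdd r r' (r + r' + 1))),
    fun inp s => ⟨_, .seq (.instr _ _) (.instr _ _), by simp [Instr.exec, show r' ≠ r + r' + 1 by omega],
      (Store.AgreeBelow.setNum (by omega) _ _).trans (.setNum le_rfl _ _), fun j hj hne => by
        simp [Instr.exec]⟩⟩

variable (Γ) in
/-- The context of the body of a loop with accumulator in cell `r`, counter in cell `r + 1`, bound in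
cell `r + 2`, and the next value of the counter in cell `r + 3`. -/
def loopBody {α : Type} {get : Store → ℕ → α} (hget : IsMemory get) (r : ℕ) (hr : Γ.depth ≤ r)
    (b : X → ℕ) (h : X → ℕ → α) : Ctx (X × ℕ) where
  inp y := Γ.inp y.1
  size y := Γ.size y.1
  two_le_size y := Γ.two_le_size y.1
  depth := r + 4
  rep y s := Γ.rep y.1 s ∧ y.2 < b y.1 ∧ get s r = h y.1 y.2 ∧ s.idx (r + 1) = y.2 ∧
    s.idx (r + 2) = b y.1 ∧ s.idx (r + 3) = y.2 + 1
  rep_congr {y s s'} hs hrep := by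
    obtain ⟨h1, h2, h3, h4, h5, h6⟩ := hrep
    refine ⟨Γ.rep_congr (hs.mono (by omega)) h1, h2, ?_, ?_, ?_, ?_⟩
    · rw [hget.congr r s s' (hs.mono (by omega)), h3]
    · rw [(hs (r + 1) (by omega)).1, h4]
    · rw [(hs (r + 2) (by omega)).1, h5]
    · rw [(hs (r + 3) (by omega)).1, h6]

theorem computes_of_cell {Δ : Ctx X} {α : Type} {get : Store → ℕ → α} (hget : IsMemory get)
    {f : X → α} (r : ℕ) (h : ∀ x s, Δ.rep x s → get s r = f x) :
    Δ.Computes get f := fun r' _ => by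
  obtain ⟨q, hq⟩ := hget.copy r' r
  refine ⟨q, 1, fun x s hs _ => ?_⟩
  obtain ⟨s', h1, h2, h3, -⟩ := hq (Δ.inp x) s
  exact ⟨s', 2, h1, h3, h2.trans (h x s hs), by simpa using Δ.two_le_size x⟩

theorem loopBody_extends {α : Type} {get : Store → ℕ → α} (hget : IsMemory get) (hr : Γ.depth ≤ r)
    {b : X → ℕ} (hb : Γ.Bounded b) (h : X → ℕ → α) :
    (Γ.loopBody hget r hr b h).Extends Γ b where
  inp _ := rfl
  size _ := rfl
  depth := show Γ.depth ≤ r + 4 by omega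
  rep _ _ hs := hs.1
  lt _ _ hs := hs.2.1
  var := by
    refine ⟨computes_of_cell isMemory_idx (r + 1) fun y s hs => hs.2.2.2.1, ?_⟩
    obtain ⟨C, hC⟩ := hb
    exact ⟨C, fun y s hs => hs.2.1.le.trans (hC y.1 s hs.1)⟩

/-- The one place where a while-loop is analysed. Quantifying the step over every extension `Δ`
hides the layout of the cells from later uses, and `h` serves as the loop invariant. The body
computes the next value afresh beyond the loop cells and copies it back. -/
theorem Computes.loop {α : Type} {get : Store → ℕ → α} (hget : IsMemory get) {b : X → ℕ}
    (hb : Γ.NatC b) (h : X → ℕ → α) (h0 : Γ.Computes get fun x => h x 0)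
    (hstep : ∀ Δ : Ctx (X × ℕ), Δ.Extends Γ b → Δ.Computes get (fun y => h y.1 y.2) →
      Δ.Computes get fun y => h y.1 (y.2 + 1)) :
    Γ.Computes get fun x => h x (b x) := by
  intro r hr
  obtain ⟨p, C, hp⟩ := hstep (Γ.loopBody hget r hr b h) (loopBody_extends hget hr hb.2 h)
    (computes_of_cell hget r fun y s hs => hs.2.2.1) (r + 4) le_rfl
  obtain ⟨q, hq⟩ := hget.copy r (r + 4)
  let body : Program := .seq (.seq (.seq (.seq p q) (.instr (.idxConst (r + 4) 1)))
    (.instr (.idxAdd (r + 1) (r + 1) (r + 4)))) (.instr (.idxAdd (r + 3) (r + 3) (r + 4)))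
  have hbody : ∀ x v s, (Γ.loopBody hget r hr b h).rep (x, v) s → ∃ s' T,
      Program.Runs (Γ.inp x) body s s' T ∧ Store.AgreeBelow r s s' ∧ get s' r = h x (v + 1) ∧
      s'.idx (r + 1) = v + 1 ∧ s'.idx (r + 2) = b x ∧ s'.idx (r + 3) = v + 2 ∧
      T ≤ Γ.size x ^ C + 5 := by
    intro x v s hs
    obtain ⟨s₁, T, h1, h2, h3, h4⟩ := hp (x, v) s hs trivial
    obtain ⟨s₂, k1, k2, k3, k4⟩ := hq (Γ.inp x) s₁
    obtain ⟨-, -, -, e1, e2, e3⟩ := hs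
    have f1 : s₂.idx (r + 1) = v := by
      rw [k4 _ (by omega) (by omega), (h2 _ (by omega)).1, e1]
    have f2 : s₂.idx (r + 2) = b x := by
      rw [k4 _ (by omega) (by omega), (h2 _ (by omega)).1, e2]
    have f3 : s₂.idx (r + 3) = v + 1 := by
      rw [k4 _ (by omega) (by omega), (h2 _ (by omega)).1, e3]
    have ha : Store.AgreeBelow (r + 1) s₂
        (((s₂.setIdx (r + 4) 1).setIdx (r + 1) (v + 1)).setIdx (r + 3) (v + 2)) :=
      ((Store.AgreeBelow.setIdx (by omega) _ _).trans (.setIdx (by omega) _ _)).trans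
        (.setIdx (by omega) _ _)
    refine ⟨((s₂.setIdx (r + 4) 1).setIdx (r + 1) (v + 1)).setIdx (r + 3) (v + 2), T + 2 + 1 + 1 + 1,
      ?_, ((h2.mono (by omega)).trans k3).trans (ha.mono (by omega)), ?_, by simp, by simp [f2],
      by simp, by have : T ≤ Γ.size x ^ C := h4; omega⟩
    · have r3 := Program.Runs.instr (inp := Γ.inp x) (.idxConst (r + 4) 1) s₂
      have r4 := Program.Runs.instr (inp := Γ.inp x) (.idxAdd (r + 1) (r + 1) (r + 4))
        (s₂.setIdx (r + 4) 1)
      have r5 := Program.Runs.instr (inp := Γ.inp x) (.idxAdd (r + 3) (r + 3) (r + 4))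
        ((s₂.setIdx (r + 4) 1).setIdx (r + 1) (v + 1))
      simp only [Instr.exec, Store.setIdx_idx] at r3 r4 r5
      simp [f1] at r4
      simp [f3] at r5
      exact .seq (.seq (.seq (.seq h1 k1) r3) r4) r5
    · rw [hget.congr r _ _ ha, k2, h3]
  -- Induction on the number m of remaining rounds. Tests offer only ≤, so v < b is tested as v + 1
  -- ≤ b; this is why cell `r + 3` holds the next counter value.
  have hwhile : ∀ m x v s, b x = v + m → Γ.rep x s → get s r = h x v → s.idx (r + 1) = v →
      s.idx (r + 2) = b x → s.idx (r + 3) = v + 1 → ∃ s' T,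
        Program.Runs (Γ.inp x) (.while (.idxLe (r + 3) (r + 2)) body) s s' T ∧
        Store.AgreeBelow r s s' ∧ get s' r = h x (b x) ∧ T ≤ m * (Γ.size x ^ C + 6) + 1 := by
    intro m
    induction m with
    | zero =>
      intro x v s hv hs e0 e1 e2 e3
      refine ⟨s, 1, .whileFalse ?_, .refl _ _, by rw [e0, hv, add_zero], by simp⟩
      simp only [Test.Holds, e2, e3]
      omega
    | succ m ih =>
      intro x v s hv hs e0 e1 e2 e3
      obtain ⟨s', T, h1, h2, h3, h4, h5, h6, h7⟩ :=
        hbody x v s ⟨hs, show v < b x by omega, e0, e1, e2, e3⟩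
      obtain ⟨s'', T', k1, k2, k3, k4⟩ :=
        ih x (v + 1) s' (by omega) (Γ.rep_congr (h2.mono hr) hs) h3 h4 h5 h6
      refine ⟨s'', T + T' + 1, .whileTrue ?_ h1 k1, h2.trans k2, k3, ?_⟩
      · simp only [Test.Holds, e2, e3]
        omega
      · rw [Nat.succ_mul]
        omega
  have hloop : Γ.Hoare r (fun x s => ((get s r = h x 0 ∧ s.idx (r + 2) = b x) ∧
      s.idx (r + 1) = 0) ∧ s.idx (r + 3) = 1) (fun x s => get s r = h x (b x)) := by
    obtain ⟨D, hD⟩ := hb.2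
    -- At most W^D rounds cost W^C + 6 ≤ W^C + W^3 ≤ W^(C+3+1) each, as W ≥ 2; the final failing
    -- test is the summand W^0.
    refine ⟨.while (.idxLe (r + 3) (r + 2)) body, D + (C + 3 + 1) + 0 + 1, fun x s hs ⟨⟨⟨e0, e2⟩, e1⟩, e3⟩ => ?_⟩
    obtain ⟨s', T, h1, h2, h3, h4⟩ := hwhile (b x) x 0 s (by omega) hs e0 e1 e2 e3
    refine ⟨s', T, h1, h2, h3, h4.trans ?_⟩
    have hW := Γ.two_le_size x
    refine le_trans ?_ (pow_add_pow_le_pow_of_two_le hW (D + (C + 3 + 1)) 0)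
    rw [pow_zero, pow_add (Γ.size x) D]
    refine Nat.add_le_add_right (Nat.mul_le_mul (hD x s hs)
      (le_trans ?_ (pow_add_pow_le_pow_of_two_le hW C 3))) 1
    have : 2 ^ 3 ≤ Γ.size x ^ 3 := Nat.pow_le_pow_left hW 3
    omega
  refine Hoare.seq hr ?_ hloop
  have hfr : ∀ x s s', Store.AgreeBelow (r + 1) s s' → get s r = h x 0 → get s' r = h x 0 :=
    fun x s s' h1 h2 => (hget.congr r s s' h1).trans h2
  -- The bound is evaluated before the counters are set, since its evaluation may overwrite any cell
  -- beyond `r + 2`.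
  refine (h0 r hr).seq hr (Hoare.seq (b := fun x s => get s r = h x 0 ∧ s.idx (r + 2) = b x) hr ?_ ?_)
  · exact Hoare.mono (Nat.le_add_right r 2) (fun x s _ h => ⟨h, trivial⟩) (fun x s h => h)
      ((hb.1 (r + 2) (by omega)).frame (F := fun x s => get s r = h x 0) fun x s s' h1 =>
        hfr x s s' (h1.mono (by omega)))
  · refine Hoare.seq (b := fun x s => (get s r = h x 0 ∧ s.idx (r + 2) = b x) ∧ s.idx (r + 1) = 0) hr
      (.instr (.idxConst (r + 1) 0) fun x s _ hs => ⟨.setIdx (by omega) _ _, ⟨hfr x s _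
        (.setIdx le_rfl _ _) hs.1, by simp [Instr.exec, hs.2]⟩, by simp [Instr.exec]⟩)
      (.instr (.idxConst (r + 3) 1) fun x s _ hs => ⟨.setIdx (by omega) _ _, ⟨⟨hfr x s _
        (.setIdx (by omega) _ _) hs.1.1, by simp [Instr.exec, hs.1.2]⟩,
          by simp [Instr.exec, hs.2]⟩, by simp [Instr.exec]⟩)

end Ctx

/-! ### Arithmetic, sums and products obtained from loops -/

namespace Ctx

variable {X : Type} {Γ : Ctx X}

theorem Bounded.mul {f g : X → ℕ} (hf : Γ.Bounded f) (hg : Γ.Bounded g) :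
    Γ.Bounded fun x => f x * g x := by
  obtain ⟨C, hC⟩ := hf
  obtain ⟨D, hD⟩ := hg
  exact ⟨C + D, fun x s hs => by
    rw [pow_add]; exact Nat.mul_le_mul (hC x s hs) (hD x s hs)⟩

theorem Bounded.mono {f g : X → ℕ} (hg : Γ.Bounded g) (h : ∀ x s, Γ.rep x s → f x ≤ g x) :
    Γ.Bounded f := by
  obtain ⟨C, hC⟩ := hg
  exact ⟨C, fun x s hs => (h x s hs).trans (hC x s hs)⟩

theorem NatC.mul {f g : X → ℕ} (hf : Γ.NatC f) (hg : Γ.NatC g) : Γ.NatC fun x => f x * g x := by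
  refine ⟨Computes.loop isMemory_idx hf (fun x v => v * g x)
    ((NatC.const 0).1.congr fun x _ _ => (zero_mul _).symm) fun Δ hΔ hv => ?_, hf.2.mul hg.2⟩
  have hb : Δ.Bounded fun y => y.2 * g y.1 := hΔ.var.2.mul (hΔ.natC hg).2
  exact (NatC.add ⟨hv, hb⟩ (hΔ.natC hg)).1.congr fun y _ _ => (Nat.succ_mul _ _).symm

/-- A positive base makes all intermediate powers at most the final one, so a bound on the result
suffices. -/
theorem NatC.pow {f g : X → ℕ} (hf : Γ.NatC f) (hg : Γ.NatC g)
    (hfg : Γ.Bounded fun x => f x ^ g x) (hpos : ∀ x s, Γ.rep x s → 0 < f x) :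
    Γ.NatC fun x => f x ^ g x := by
  refine ⟨Computes.loop isMemory_idx hg (fun x v => f x ^ v)
    ((NatC.const 1).1.congr fun x _ _ => (pow_zero _).symm) fun Δ hΔ hv => ?_, hfg⟩
  have hb : Δ.Bounded fun y => f y.1 ^ y.2 := by
    obtain ⟨C, hC⟩ := hfg
    refine ⟨C, fun y s hs => ?_⟩
    rw [hΔ.size]
    exact (Nat.pow_le_pow_right (hpos y.1 s (hΔ.rep y s hs)) (hΔ.lt y s hs).le).trans
      (hC y.1 s (hΔ.rep y s hs))
  exact (NatC.mul ⟨hv, hb⟩ (hΔ.natC hf)).1.congr fun y _ _ => (pow_succ _ _).symm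

/-- Counting. -/
theorem NatC.sum_indicator {b : X → ℕ} (hb : Γ.NatC b) (g : X → ℕ → ℕ)
    (hg1 : ∀ x v, g x v ≤ 1)
    (hg : ∀ Δ : Ctx (X × ℕ), Δ.Extends Γ b → Δ.NatC fun y => g y.1 y.2) :
    Γ.NatC fun x => ∑ v ∈ Finset.range (b x), g x v := by
  have hle : ∀ x n, ∑ v ∈ Finset.range n, g x v ≤ n := fun x n => by
    simpa using Finset.sum_le_card_nsmul (Finset.range n) (g x) 1 fun v _ => hg1 x v
  refine ⟨Computes.loop isMemory_idx hb (fun x n => ∑ v ∈ Finset.range n, g x v)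
    ((NatC.const 0).1.congr fun x _ _ => by simp) fun Δ hΔ hv => ?_,
    hb.2.mono fun x _ _ => hle x (b x)⟩
  have hbd : Δ.Bounded fun y => ∑ v ∈ Finset.range y.2, g y.1 v :=
    hΔ.var.2.mono fun y _ _ => hle y.1 y.2
  exact (NatC.add ⟨hv, hbd⟩ (hg Δ hΔ)).1.congr fun y _ _ => (Finset.sum_range_succ _ _).symm

/-- Division becomes counting the v with (v + 1) n ≤ a, and truncated subtraction supplies the
indicator. -/
theorem div_eq_sum_range (a : ℕ) {n : ℕ} (hn : 0 < n) :
    a / n = ∑ v ∈ Finset.range a, (1 - ((v + 1) * n - a)) := by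
  have h : ∀ v, 1 - ((v + 1) * n - a) = if v < a / n then 1 else 0 := fun v => by
    have : v < a / n ↔ (v + 1) * n ≤ a := by
      rw [← Nat.le_div_iff_mul_le hn, Nat.succ_le_iff]
    split_ifs with hv <;> rw [this] at hv <;> omega
  simp_rw [h]
  rw [Finset.sum_boole]
  have : (Finset.range a).filter (fun v => v < a / n) = Finset.range (a / n) := by
    ext v
    simp only [Finset.mem_filter, Finset.mem_range]
    exact ⟨fun h => h.2, fun h => ⟨h.trans_le (Nat.div_le_self _ _), h⟩⟩
  rw [this]
  simp

theorem NatC.div {f g : X → ℕ} (hf : Γ.NatC f) (hg : Γ.NatC g)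
    (hpos : ∀ x s, Γ.rep x s → 0 < g x) : Γ.NatC fun x => f x / g x := by
  refine (NatC.sum_indicator hf (fun x v => 1 - ((v + 1) * g x - f x)) (fun _ _ => Nat.sub_le _ _)
    fun Δ hΔ => ?_).congr fun x s hs => (div_eq_sum_range (f x) (hpos x s hs)).symm
  exact (NatC.const 1).sub (((hΔ.var.add (NatC.const 1)).mul (hΔ.natC hg)).sub (hΔ.natC hf))

theorem NatC.mod {f g : X → ℕ} (hf : Γ.NatC f) (hg : Γ.NatC g)
    (hpos : ∀ x s, Γ.rep x s → 0 < g x) : Γ.NatC fun x => f x % g x :=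
  (hf.sub (hg.mul (hf.div hg hpos))).congr fun x _ _ => by
    have := Nat.mod_add_div (f x) (g x)
    omega

theorem NatC.ne {f g : X → ℕ} (hf : Γ.NatC f) (hg : Γ.NatC g) :
    Γ.NatC fun x => if f x ≠ g x then 1 else 0 :=
  ((NatC.const 1).sub ((NatC.const 1).sub ((hf.sub hg).add (hg.sub hf)))).congr fun x _ _ => by
    split_ifs <;> omega

theorem NumC.sum {b : X → ℕ} (hb : Γ.NatC b) (g : X → ℕ → ℂ)
    (hg : ∀ Δ : Ctx (X × ℕ), Δ.Extends Γ b → Δ.NumC fun y => g y.1 y.2) :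
    Γ.NumC fun x => ∑ v ∈ Finset.range (b x), g x v :=
  Computes.loop isMemory_num hb (fun x n => ∑ v ∈ Finset.range n, g x v)
    ((NumC.const 0).congr fun x _ _ => by simp) fun Δ hΔ hv =>
      (NumC.add hv (hg Δ hΔ)).congr fun y _ _ => (Finset.sum_range_succ _ _).symm

theorem NumC.prod {b : X → ℕ} (hb : Γ.NatC b) (g : X → ℕ → ℂ)
    (hg : ∀ Δ : Ctx (X × ℕ), Δ.Extends Γ b → Δ.NumC fun y => g y.1 y.2) :
    Γ.NumC fun x => ∏ v ∈ Finset.range (b x), g x v :=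
  Computes.loop isMemory_num hb (fun x n => ∏ v ∈ Finset.range n, g x v)
    ((NumC.const 1).congr fun x _ _ => by simp) fun Δ hΔ hv =>
      (NumC.mul hv (hg Δ hΔ)).congr fun y _ _ => (Finset.prod_range_succ _ _).symm

theorem NumC.pow {f : X → ℂ} {b : X → ℕ} (hf : Γ.NumC f) (hb : Γ.NatC b) :
    Γ.NumC fun x => f x ^ b x :=
  (NumC.prod hb (fun x _ => f x) fun _ hΔ => hΔ.numC hf).congr fun x _ _ => by simp

theorem NatC.cast {f : X → ℕ} (hf : Γ.NatC f) : Γ.NumC fun x => (f x : ℂ) :=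
  (NumC.sum hf (fun _ _ => 1) fun _ _ => NumC.const 1).congr fun x _ _ => by simp

theorem NatC.factorial {f : X → ℕ} (hf : Γ.NatC f) : Γ.NumC fun x => ((f x).factorial : ℂ) :=
  (NumC.prod hf (fun _ v => ((v + 1 : ℕ) : ℂ)) fun _ hΔ => (hΔ.var.add (NatC.const 1)).cast).congr
    fun x _ _ => by rw [← Finset.prod_range_add_one_eq_factorial]; push_cast; rfl

theorem NatC.descFactorial {f g : X → ℕ} (hf : Γ.NatC f) (hg : Γ.NatC g) :
    Γ.NumC fun x => ((f x).descFactorial (g x) : ℂ) :=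
  (NumC.prod hg (fun x v => ((f x - v : ℕ) : ℂ)) fun _ hΔ =>
    ((hΔ.natC hf).sub hΔ.var).cast).congr
      fun x _ _ => by rw [Nat.descFactorial_eq_prod_range]; push_cast; rfl

end Ctx

/-! ### The truncated expansion as an explicit formula -/

theorem finFunctionFinEquiv_digit {m k : ℕ} (f : Fin k → Fin m) (i : Fin k) :
    (finFunctionFinEquiv f : ℕ) / m ^ (i : ℕ) % m = f i :=
  congrArg Fin.val (congrFun (finFunctionFinEquiv.symm_apply_apply f) i)

theorem Tensor.inputArray_finFunctionFinEquiv {d n : ℕ} (R : Tensor d n) (p : Fin d → Fin n) :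
    R.inputArray (finFunctionFinEquiv p) = R p := by
  rw [Tensor.inputArray, dif_pos (Fin.is_lt _)]
  exact congrArg R (finFunctionFinEquiv.symm_apply_apply p)

/-- Passing from injections to all functions with an indicator gives an index set that integers
below (n^d)^k enumerate exactly. -/
theorem Tensor.injSum_eq_sum_ite {d n : ℕ} (A : Tensor d n) (k : ℕ) :
    A.injSum k = ∑ f : Fin k → Fin d → Fin n,
      if ∀ j, Function.Injective fun i => f i j then ∏ i, A (f i) else 0 := by
  rw [← Finset.sum_filter, Tensor.injSum]
  refine Finset.sum_bij (fun g _ => fun i j => g j i) ?_ ?_ ?_ ?_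
  · intro g _
    simpa using fun j => (g j).injective
  · intro g _ g' _ h
    funext j
    ext i
    exact congrArg Fin.val (congrFun (congrFun h i) j)
  · intro f hf
    exact ⟨fun j => ⟨fun i => f i j, (Finset.mem_filter.1 hf).2 j⟩, Finset.mem_univ _, rfl⟩
  · intro g _
    rfl

/-- The indicator function of the property that the tuple of positions encoded by `N` is pairwise
different in every index. -/
noncomputable def distinctIndicator (n d k N : ℕ) : ℂ :=
  ∏ i' ∈ Finset.range k, ∏ i ∈ Finset.range i', ∏ j ∈ Finset.range d,
    ((if N / (n ^ d) ^ i % n ^ d / n ^ j % n ≠ N / (n ^ d) ^ i' % n ^ d / n ^ j % n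
      then 1 else 0 : ℕ) : ℂ)

theorem distinctIndicator_encode {n d k : ℕ} (f : Fin k → Fin d → Fin n) :
    distinctIndicator n d k (finFunctionFinEquiv fun i => finFunctionFinEquiv (f i)) =
      if ∀ j, Function.Injective fun i => f i j then 1 else 0 := by
  have hdig : ∀ (i : Fin k) (j : Fin d),
      ((finFunctionFinEquiv fun i => finFunctionFinEquiv (f i) : Fin ((n ^ d) ^ k)) : ℕ) /
        (n ^ d) ^ (i : ℕ) % n ^ d / n ^ (j : ℕ) % n = f i j := fun i j => by
    rw [finFunctionFinEquiv_digit, finFunctionFinEquiv_digit]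
  have hiff : (∀ j, Function.Injective fun i => f i j) ↔
      ∀ i' ∈ Finset.range k, ∀ i ∈ Finset.range i', ∀ j ∈ Finset.range d,
        ((finFunctionFinEquiv fun i => finFunctionFinEquiv (f i) : Fin ((n ^ d) ^ k)) : ℕ) /
          (n ^ d) ^ i % n ^ d / n ^ j % n ≠
        ((finFunctionFinEquiv fun i => finFunctionFinEquiv (f i) : Fin ((n ^ d) ^ k)) : ℕ) /
          (n ^ d) ^ i' % n ^ d / n ^ j % n := by
    simp only [Finset.mem_range]
    constructor
    · intro h i' hi' i hi j hj he
      have h1 := hdig ⟨i, hi.trans hi'⟩ ⟨j, hj⟩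
      have h2 := hdig ⟨i', hi'⟩ ⟨j, hj⟩
      simp only at h1 h2
      rw [h1, h2] at he
      have := h ⟨j, hj⟩ (Fin.ext he)
      exact hi.ne (congrArg Fin.val this)
    · intro h j a b hab
      by_contra hne
      simp only at hab
      rcases lt_or_gt_of_ne hne with hlt | hlt
      · refine h b b.2 a hlt j j.2 ?_
        rw [hdig, hdig, hab]
      · refine h a a.2 b hlt j j.2 ?_
        rw [hdig, hdig, hab]
  rw [distinctIndicator]
  simp only [Nat.cast_ite, Nat.cast_one, Nat.cast_zero, Finset.prod_ite_zero,
    Finset.prod_const_one]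
  exact if_congr hiff.symm rfl rfl

/-- A two-level encoding: a position is a base-n number, equal to its place in the input array, and
a k-tuple of positions is a number in base n^d. -/
theorem Tensor.injSum_sub_eq_sum_range {d n : ℕ} (R : Tensor d n) (μ : ℂ) (k : ℕ) :
    Tensor.injSum (R - μ • Tensor.allOnes d n) k =
      ∑ N ∈ Finset.range ((n ^ d) ^ k), distinctIndicator n d k N *
        ∏ i ∈ Finset.range k, (R.inputArray (N / (n ^ d) ^ i % n ^ d) - μ) := by
  rw [Tensor.injSum_eq_sum_ite, Finset.sum_range]
  refine Fintype.sum_equiv ((Equiv.arrowCongr (Equiv.refl (Fin k)) finFunctionFinEquiv).trans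
    finFunctionFinEquiv) _ _ fun f => ?_
  have he : ((Equiv.arrowCongr (Equiv.refl (Fin k)) finFunctionFinEquiv).trans
    finFunctionFinEquiv) f = finFunctionFinEquiv fun i => finFunctionFinEquiv (f i) := rfl
  rw [he, distinctIndicator_encode, Finset.prod_range, ite_mul, one_mul, zero_mul]
  refine if_congr Iff.rfl (Finset.prod_congr rfl fun i _ => ?_) rfl
  rw [finFunctionFinEquiv_digit, Tensor.inputArray_finFunctionFinEquiv]
  simp [Tensor.allOnes]

/-- The number of terms of the truncated expansion, not counting the constant term. -/
noncomputable def truncationDegree (n : ℕ) (ε : ℝ) : ℕ := min n ⌊Real.log (n / ε)⌋₊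

theorem filter_range_le_log {n : ℕ} (hn : 2 ≤ n) {ε : ℝ} (hε : 0 < ε) (hε1 : ε < 1) :
    (Finset.range (n + 1)).filter (fun k : ℕ => (k : ℝ) ≤ Real.log (n / ε)) =
      Finset.range (truncationDegree n ε + 1) := by
  have hnR : (2 : ℝ) ≤ n := by exact_mod_cast hn
  have hL : 0 ≤ Real.log (n / ε) := Real.log_nonneg (by rw [le_div_iff₀ hε]; linarith)
  ext k
  simp only [Finset.mem_filter, Finset.mem_range, truncationDegree, Nat.lt_succ_iff, le_min_iff,
    Nat.le_floor_iff hL]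

-- Avoids logarithms: with e as a machine constant, j + 1 ≤ ln(n/ε) is the test e^(j+1) ε ≤ n, and
-- letting j run below n imposes the minimum with n.
open Classical in
theorem truncationDegree_eq_sum {n : ℕ} (hn : 2 ≤ n) {ε : ℝ} (hε : 0 < ε) (hε1 : ε < 1) :
    truncationDegree n ε = ∑ j ∈ Finset.range n,
      if (((Real.exp 1 : ℝ) : ℂ) ^ (j + 1) * (ε : ℂ)).re ≤ ((n : ℕ) : ℂ).re then 1 else 0 := by
  have hnR : (2 : ℝ) ≤ n := by exact_mod_cast hn
  have hL : 0 ≤ Real.log (n / ε) := Real.log_nonneg (by rw [le_div_iff₀ hε]; linarith)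
  have hiff : ∀ j : ℕ, (((Real.exp 1 : ℝ) : ℂ) ^ (j + 1) * (ε : ℂ)).re ≤ ((n : ℕ) : ℂ).re ↔
      j < ⌊Real.log (n / ε)⌋₊ := fun j => by
    have : (((Real.exp 1 : ℝ) : ℂ) ^ (j + 1) * (ε : ℂ)).re = Real.exp ((j + 1 : ℕ) : ℝ) * ε := by
      rw [← Complex.ofReal_pow, ← Complex.ofReal_mul, Complex.ofReal_re, ← Real.exp_nat_mul,
        mul_one]
    rw [this, Complex.natCast_re, ← le_div_iff₀ hε, ← Real.le_log_iff_exp_le (by positivity),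
      ← Nat.le_floor_iff hL, Nat.succ_le_iff]
  simp_rw [hiff]
  rw [Finset.sum_boole]
  have : (Finset.range n).filter (fun j => j < ⌊Real.log (n / ε)⌋₊) =
      Finset.range (truncationDegree n ε) := by
    ext j
    simp [truncationDegree]
  rw [this]
  simp

theorem Tensor.truncatedPer_eq {d n : ℕ} (hd : 0 < d) (hn : 2 ≤ n) (R : Tensor d n) (μ : ℂ)
    {ε : ℝ} (hε : 0 < ε) (hε1 : ε < 1) :
    R.truncatedPer μ ε = μ ^ n * (n.factorial : ℂ) ^ (d - 1) *
      ∑ k ∈ Finset.range (truncationDegree n ε + 1),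
        1 / ((n.descFactorial k : ℂ) ^ (d - 1) * k.factorial) *
          (∑ N ∈ Finset.range ((n ^ d) ^ k), distinctIndicator n d k N *
            ∏ i ∈ Finset.range k, (R.inputArray (N / (n ^ d) ^ i % n ^ d) - μ)) * (1 / μ) ^ k := by
  rw [Tensor.truncatedPer, filter_range_le_log hn hε hε1]
  simp_rw [Tensor.coeff_eq_injSum hd, Tensor.injSum_sub_eq_sum_range]

/-! ### The program -/

namespace Ctx

variable {X : Type} {Γ : Ctx X}

theorem NatC.digit {m i N : X → ℕ} (hm : Γ.NatC m) (hi : Γ.NatC i) (hN : Γ.NatC N)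
    (hb : Γ.Bounded fun x => m x ^ i x) (hpos : ∀ x, 0 < m x) :
    Γ.NatC fun x => N x / m x ^ i x % m x :=
  (hN.div (hm.pow hi hb fun _ _ _ => hpos _) fun _ _ _ => pow_pos (hpos _) _).mod hm
    fun _ _ _ => hpos _

theorem NumC.distinctIndicator {n d k N : X → ℕ} (hn : Γ.NatC n) (hd : Γ.NatC d) (hk : Γ.NatC k)
    (hN : Γ.NatC N) (hM : Γ.NatC fun x => n x ^ d x) (hB : Γ.NatC fun x => (n x ^ d x) ^ k x)
    (hpos : ∀ x, 0 < n x) : Γ.NumC fun x => distinctIndicator (n x) (d x) (k x) (N x) := by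
  have hM0 : ∀ x, 0 < n x ^ d x := fun x => pow_pos (hpos x) _
  refine NumC.prod hk _ fun Δ₁ h₁ => NumC.prod h₁.var _ fun Δ₂ h₂ =>
    NumC.prod (h₂.natC (h₁.natC hd)) _ fun Δ₃ h₃ => NatC.cast ?_
  have hn₃ := h₃.natC (h₂.natC (h₁.natC hn))
  have hM₂ := h₂.natC (h₁.natC hM)
  have hN₂ := h₂.natC (h₁.natC hN)
  have hB₂ := (h₂.natC (h₁.natC hB)).2
  -- Digit weights must be polynomially bounded, being built by index loops. Here n^j ≤ n^d, and
  -- below (n^d)^i ≤ (n^d)^k.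
  have hb : Δ₃.Bounded fun y => n y.1.1.1 ^ y.2 := (h₃.natC hM₂).2.mono fun y s hs =>
    Nat.pow_le_pow_right (hpos _) (h₃.lt y s hs).le
  refine NatC.ne (NatC.digit hn₃ h₃.var (h₃.natC (NatC.digit hM₂ h₂.var hN₂ ?_ fun _ => hM0 _)) hb
    fun _ => hpos _) (NatC.digit hn₃ h₃.var (h₃.natC (NatC.digit hM₂ (h₂.natC h₁.var) hN₂ ?_
      fun _ => hM0 _)) hb fun _ => hpos _)
  · exact hB₂.mono fun y s hs => Nat.pow_le_pow_right (hM0 _)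
      ((h₂.lt y s hs).trans (h₁.lt y.1 s (h₂.rep y s hs))).le
  · exact hB₂.mono fun y s hs => Nat.pow_le_pow_right (hM0 _)
      (h₁.lt y.1 s (h₂.rep y s hs)).le

end Ctx

/-- An admissible input of the program. -/
structure PermInput where
  /-- the dimension -/
  n : ℕ
  /-- the order -/
  d : ℕ
  two_le : 2 ≤ n
  three_le : 3 ≤ d
  /-- the tensor -/
  R : Tensor d n
  /-- the mean -/
  μ : ℂ
  /-- the precision -/
  ε : ℝ
  pos : 0 < ε
  lt_one : ε < 1

/-- The number of terms of the truncated expansion, not counting the constant term. -/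
noncomputable def PermInput.degree (x : PermInput) : ℕ := truncationDegree x.n x.ε

theorem PermInput.pos_n (x : PermInput) : 0 < x.n := by have := x.two_le; omega

/-- The context given by the initial memory. -/
noncomputable def permCtx : Ctx PermInput where
  inp x := x.R.inputArray
  -- This dominates the number (n^d)^k of tuples for every k up to the degree; the extra 1 keeps it
  -- at least n^d when the degree is 0.
  size x := x.n ^ (x.d * (x.degree + 1))
  two_le_size x := x.two_le.trans (le_self_pow₀ (by have := x.two_le; omega)
    (Nat.mul_ne_zero (by have := x.three_le; omega) (Nat.succ_ne_zero _)))
  depth := 2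
  rep x s := s.idx 0 = x.n ∧ s.idx 1 = x.d ∧ s.num 0 = x.μ ∧ s.num 1 = (x.ε : ℂ)
  rep_congr {x s s'} h hs := by
    rw [(h 0 (by omega)).1, (h 1 (by omega)).1, (h 0 (by omega)).2, (h 1 (by omega)).2]
    exact hs

namespace permCtx

open Ctx

theorem le_size {x : PermInput} {e : ℕ} (he : e ≤ x.degree + 1) :
    (x.n ^ x.d) ^ e ≤ permCtx.size x := by
  rw [← pow_mul]
  exact Nat.pow_le_pow_right x.pos_n (Nat.mul_le_mul_left _ he)

theorem natC_n : permCtx.NatC PermInput.n :=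
  ⟨computes_of_cell isMemory_idx 0 fun _ _ hs => hs.1, 1, fun x _ _ => by
    rw [pow_one]
    refine le_trans ?_ (le_size (x := x) (e := 1) (by omega))
    rw [pow_one]
    exact le_self_pow₀ x.pos_n (by have := x.three_le; omega)⟩

theorem natC_d : permCtx.NatC PermInput.d :=
  ⟨computes_of_cell isMemory_idx 1 fun _ _ hs => hs.2.1, 1, fun x _ _ => by
    rw [pow_one]
    refine le_trans ?_ (le_size (x := x) (e := 1) (by omega))
    rw [pow_one]
    exact (Nat.lt_pow_self x.two_le).le⟩

theorem numC_μ : permCtx.NumC PermInput.μ := computes_of_cell isMemory_num 0 fun _ _ hs => hs.2.2.1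

theorem numC_ε : permCtx.NumC fun x => (x.ε : ℂ) :=
  computes_of_cell isMemory_num 1 fun _ _ hs => hs.2.2.2

theorem natC_positions : permCtx.NatC fun x => x.n ^ x.d :=
  natC_n.pow natC_d ⟨1, fun x _ _ => by simpa using le_size (x := x) (e := 1) (by omega)⟩
    fun x _ _ => x.pos_n

theorem natC_degree : permCtx.NatC PermInput.degree := by
  classical
  refine (NatC.sum_indicator natC_n (fun x j =>
    if (((Real.exp 1 : ℝ) : ℂ) ^ (j + 1) * (x.ε : ℂ)).re ≤ (x.n : ℂ).re then 1 else 0)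
    (fun _ _ => by split_ifs <;> simp) fun Δ hΔ => ?_).congr fun x _ _ =>
      (truncationDegree_eq_sum x.two_le x.pos x.lt_one).symm
  refine (NatC.numLe (((NumC.const ((Real.exp 1 : ℝ) : ℂ)).pow (hΔ.var.add (NatC.const 1))).mul (hΔ.numC numC_ε))
    (hΔ.natC natC_n).cast).congr fun y _ _ => ?_
  congr

theorem numC_truncatedPer : permCtx.NumC fun x => x.R.truncatedPer x.μ x.ε := by
  have hd1 : permCtx.NatC fun x => x.d - 1 := natC_d.sub (NatC.const 1)
  refine NumC.congr ?_ fun x _ _ => (Tensor.truncatedPer_eq (by have := x.three_le; omega) x.two_le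
    x.R x.μ x.pos x.lt_one).symm
  refine ((numC_μ.pow natC_n).mul (natC_n.factorial.pow hd1)).mul
    (NumC.sum (natC_degree.add (NatC.const 1)) _ fun Δ h => ?_)
  have hM := h.natC natC_positions
  have hB : Δ.NatC fun y => (y.1.n ^ y.1.d) ^ y.2 :=
    hM.pow h.var ⟨1, fun y s hs => by
      rw [pow_one, h.size]; exact le_size (h.lt y s hs).le⟩ fun y _ _ => pow_pos y.1.pos_n _
  refine NumC.mul (NumC.mul ((NumC.const 1).div (NumC.mul
    (((h.natC natC_n).descFactorial h.var).pow (h.natC hd1)) h.var.factorial))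
    (NumC.sum hB _ fun Δ' h' => NumC.mul ?_ (NumC.prod (h'.natC h.var) _ fun Δ'' h'' => ?_)))
    (((NumC.const 1).div (h.numC numC_μ)).pow h.var)
  · exact NumC.distinctIndicator (h'.natC (h.natC natC_n)) (h'.natC (h.natC natC_d))
      (h'.natC h.var) h'.var (h'.natC hM) (h'.natC hB) fun y => y.1.1.pos_n
  · refine NumC.sub (NumC.congr (NumC.input (NatC.digit (h''.natC (h'.natC hM)) h''.var
      (h''.natC h'.var) ((h''.natC (h'.natC hB)).2.mono fun y s hs =>
        Nat.pow_le_pow_right (pow_pos y.1.1.1.pos_n _) (h''.lt y s hs).le)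
      fun y => pow_pos y.1.1.1.pos_n _)) fun y _ _ => ?_) (h''.numC (h'.numC (h.numC numC_μ)))
    rw [h''.inp, h'.inp, h.inp]
    rfl

end permCtx

theorem exists_program_truncatedPer : ∃ (P : Program) (C : ℕ), ∀ x : PermInput, ∃ T : ℕ,
    P.Outputs x.R x.μ x.ε (x.R.truncatedPer x.μ x.ε) T ∧ T ≤ permCtx.size x ^ C := by
  -- Cells 0 and 1 hold the input, so the value is computed in cell 2 and then copied to the output
  -- cell 0.
  obtain ⟨p, C, hp⟩ := permCtx.numC_truncatedPer 2 le_rfl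
  obtain ⟨q, hq⟩ := Ctx.isMemory_num.copy 0 2
  refine ⟨.seq p q, C + 1 + 1, fun x => ?_⟩
  obtain ⟨s, T, h1, -, h3, h4⟩ := hp x (initialStore x.n x.d x.μ x.ε)
    (by simp [permCtx, initialStore]) trivial
  obtain ⟨s', k1, k2, -⟩ := hq x.R.inputArray s
  refine ⟨T + 2, ⟨s', .seq h1 k1, k2.trans h3⟩, ?_⟩
  have hW := permCtx.two_le_size x
  refine le_trans (Nat.add_le_add h4 ?_) (pow_add_pow_le_pow_of_two_le hW C 1)
  simpa using hW

theorem permCtx.size_pow_le (x : PermInput) (C : ℕ) :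
    ((permCtx.size x ^ C : ℕ) : ℝ) ≤ (x.n : ℝ) ^ (3 * C * x.d * Real.log (x.n / x.ε)) := by
  have hn : (2 : ℝ) ≤ x.n := by exact_mod_cast x.two_le
  -- With L = ln(n/ε) ≥ ln 2 > 1/2, degree + 1 ≤ L + 1 ≤ 3L; this is the source of the factor 3 in
  -- the exponent.
  have hlog2 : (1 / 2 : ℝ) ≤ Real.log (x.n / x.ε) := by
    have h1 : Real.log 2 ≤ Real.log (x.n / x.ε) := Real.log_le_log (by norm_num) (by
      rw [le_div_iff₀ x.pos]
      nlinarith [x.pos, x.lt_one])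
    linarith [Real.log_two_gt_d9]
  have hdeg : (x.degree : ℝ) ≤ Real.log (x.n / x.ε) := by
    have : (x.degree : ℝ) ≤ (⌊Real.log (x.n / x.ε)⌋₊ : ℝ) := by
      exact_mod_cast min_le_right _ _
    exact this.trans (Nat.floor_le (by linarith))
  have : ((permCtx.size x ^ C : ℕ) : ℝ) = (x.n : ℝ) ^ ((x.d * (x.degree + 1) * C : ℕ) : ℝ) := by
    rw [Real.rpow_natCast]
    simp [permCtx, ← pow_mul]
  rw [this]
  refine Real.rpow_le_rpow_of_exponent_le (by linarith) ?_
  push_cast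
  have hdC : (0 : ℝ) ≤ C * x.d := by positivity
  calc (x.d * (x.degree + 1) * C : ℝ) = C * x.d * (x.degree + 1) := by ring
    _ ≤ C * x.d * (3 * Real.log (x.n / x.ε)) := by
      gcongr
      linarith
    _ = _ := by ring

/-! ### The main theorem -/

theorem mainTheorem1 (c : ℝ) (hc₀ : 0 < c) (hc₁ : c < 1 / 8) :
    ∃ (P : Program) (K : ℝ),
      -- the expansion that is truncated
      (∀ (d n : ℕ), 3 ≤ d → ∀ (A : Tensor d n) (z : ℂ),
        Tensor.per (Tensor.allOnes d n + z • A) / (n.factorial : ℂ) ^ (d - 1) =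
          ∑ k ∈ Finset.range (n + 1), A.coeff k * z ^ k) ∧
      -- the output of the program and its running time
      (∀ (d n : ℕ), 3 ≤ d → 2 ≤ n → ∀ (R : Tensor d n) (μ : ℂ), μ ≠ 0 →
        ∀ ε : ℝ, 0 < ε → ε < 1 →
          ∃ T : ℕ, P.Outputs R μ ε (R.truncatedPer μ ε) T ∧
            (T : ℝ) ≤ (n : ℝ) ^ (K * d * Real.log (n / ε))) ∧
      -- the output is an approximation of the permanent, with probability `1 - o(1)`
      (∀ d : ℕ → ℕ, (∀ n, 3 ≤ d n) →
        (∃ k : ℕ, (fun n : ℕ => (d n : ℝ)) =O[atTop] (fun n : ℕ => Real.log n ^ k)) →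
        ∀ ρ δ : ℝ, 0 < δ → ∀ᶠ n : ℕ in atTop,
          ∀ (μ : ℂ) (ν : Measure ℂ), IsEntryDistribution ν μ ρ →
            (Real.log n / ((d n : ℝ) - 1) ^ 6) ^ (-c) ≤ ‖μ‖ →
            ∀ ε : ℝ, 0 < ε → ε < 1 →
              tensorLaw (d n) n ν
                {R | ¬ (R.per ≠ 0 ∧ ∃ (y : ℂ) (T : ℕ), P.Outputs R μ ε y T ∧
                  ‖1 - y / R.per‖ ≤ ε)} ≤ ENNReal.ofReal δ) := by
  obtain ⟨P, C, hP⟩ := exists_program_truncatedPer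
  refine ⟨P, 3 * C, fun d n hd A z => Tensor.per_allOnes_add_smul (by omega) A z, ?_, ?_⟩
  · intro d n hd hn R μ _ ε hε hε1
    obtain ⟨T, hT, hle⟩ := hP ⟨n, d, hn, hd, R, μ, ε, hε, hε1⟩
    exact ⟨T, hT, (Nat.cast_le.2 hle).trans (permCtx.size_pow_le _ C)⟩
  · intro d hd _ ρ δ hδ
    filter_upwards [eventually_tensorLaw_bad_le hc₀ hc₁ d hd ρ hδ] with n hn
    intro μ ν hν hμ ε hε hε1
    obtain ⟨_, hn2, hle⟩ := hn μ ν hν hμ ε hε hε1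
    refine (measure_mono ?_).trans hle
    -- The program outputs the truncated expansion on every input, so failure of the program forces
    -- failure of the truncation.
    intro R hR hgood
    obtain ⟨T, hT, -⟩ := hP ⟨n, d n, hn2, hd n, R, μ, ε, hε, hε1⟩
    exact hR ⟨hgood.1, _, T, hT, hgood.2⟩
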